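/- Let $u\colon R\to U$ be a flat epimorphism of commutative rings, that is, a homomorphism of commutative rings such that $U$ is a flat $R$-module and the multiplication map $U\otimes_R U\to U$ is an isomorphism. Let $\mathbb G$ be the set of all ideals $I\subset R$ such that $R/I\otimes_R U=0$ (equivalently, $IU=U$). Assume that, for every $I\in\mathbb G$, the quotient ring $R/I$ is semilocal of Krull dimension zero, i.e., $R/I$ has only finitely many maximal ideals and all its prime ideals are maximal. An $R$-module $C$ is called a $u$-contramodule if $\operatorname{Hom}_R(U,C)=0=\operatorname{Ext}^1_R(U,C)$. Given a class $\mathsf E$ of $R$-modules, the class of $R$-modules simply right obtainable from $\mathsf E$ is the smallest class of $R$-modules that contains $\mathsf E$ and is closed under isomorphisms, extensions, cokernels of monomorphisms, infinite products, and infinitely iterated extensions in the sense of the projective limit. The last condition means the following: whenever $\delta$ is an ordinal and $(C_i\leftarrow C_j)_{0\le i\le j\le\delta}$ is a projective system of $R$-modules such that $C_0=0$, the map $C_{i+1}\to C_i$ is surjective with its kernel belonging to the class for every $i<\delta$, and the natural map $C_j\to\varprojlim_{i<j}C_i$ is an isomorphism for every limit ordinal $j\le\delta$, the module $C_\delta$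 belongs to the class. Then an $R$-module is a $u$-contramodule if and only if it is simply right obtainable from the class of all $R$-modules that are $R/I$-modules for some $I\in\mathbb G$. -/

import Mathlib

universe u

/-- The set of all ideals `I` of `R` such that `(R ⧸ I) ⊗[R] U = 0`
(for a flat epimorphism `R → U`, this is the associated Gabriel filter). -/
def gabrielFilter (R U : Type u) [CommRing R] [CommRing U] [Algebra R U] : Set (Ideal R) :=
  {I | Subsingleton (TensorProduct R (R ⧸ I) U)}

/-- A commutative ring is semilocal of Krull dimension zero if it has only finitely many maximal
ideals and all its prime ideals are maximal. (The zero ring is included: `I = R` always belongs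
to the Gabriel filter.) -/
def IsSemilocalOfKrullDimZero (T : Type u) [CommRing T] : Prop :=
  {m : Ideal T | m.IsMaximal}.Finite ∧ ∀ p : Ideal T, p.IsPrime → p.IsMaximal

/-- An `R`-module `C` is a `u`-contramodule, for `u : R → U` the structure map of the
`R`-algebra `U`, if `Hom_R(U, C) = 0` and `Ext^1_R(U, C) = 0`. -/
def IsUContramodule (R U : Type u) [CommRing R] [CommRing U] [Algebra R U]
    (C : Type u) [AddCommGroup C] [Module R C] : Prop :=
  Subsingleton (U →ₗ[R] C) ∧
    Subsingleton (CategoryTheory.Abelian.Ext (ModuleCat.of R U) (ModuleCat.of R C) 1)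

/-- The `R`-modules whose `R`-module structure comes from an `R ⧸ I`-module structure for some
ideal `I` belonging to the set of ideals `G`. -/
def IsQuotientRingModule {R : Type u} [CommRing R] (G : Set (Ideal R))
    (M : Type u) [AddCommGroup M] [Module R M] : Prop :=
  ∃ I ∈ G, ∃ _ : Module (R ⧸ I) M, IsScalarTower R (R ⧸ I) M

/-- A projective system `M i ← M j`, `i ≤ j ≤ δ`, of `R`-modules indexed by the ordinals up to
`δ` (the values at ordinals greater than `δ` are irrelevant) which presents `M δ` as an
iterated extension, in the sense of the projective limit, of the kernels
of the maps `M (i + 1) → M i`, `i < δ`. -/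
structure IsProjIteratedExtension {R : Type u} [CommRing R] (δ : Ordinal.{u})
    (M : Ordinal.{u} → Type u) [∀ i, AddCommGroup (M i)] [∀ i, Module R (M i)]
    (f : ∀ i j : Ordinal.{u}, i ≤ j → (M j →ₗ[R] M i)) : Prop where
  map_id : ∀ i, i ≤ δ → ∀ x : M i, f i i le_rfl x = x
  map_comp : ∀ (i j k : Ordinal.{u}) (hij : i ≤ j) (hjk : j ≤ k), k ≤ δ → ∀ x : M k,
    f i j hij (f j k hjk x) = f i k (hij.trans hjk) x
  /-- The system starts from the zero module. -/
  zero : Subsingleton (M 0)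
  /-- The maps at the successor steps are surjective. -/
  succ : ∀ i, i < δ → Function.Surjective (f i (Order.succ i) (Order.le_succ i))
  /-- At a limit ordinal `j`, the natural map from `M j` to the projective limit of the `M i`,
  `i < j`, is bijective. -/
  limit : ∀ j, j ≤ δ → Order.IsSuccLimit j → ∀ x : (∀ i : Set.Iio j, M i),
    (∀ (i k : Set.Iio j) (hik : (i : Ordinal.{u}) ≤ k), f i k hik (x k) = x i) →
      ∃! y : M j, ∀ i : Set.Iio j, f i j (le_of_lt i.2) y = x i

/-- The class of `R`-modules simply right obtainable from a class `E` of `R`-modules: the smallest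
class of `R`-modules containing `E` and closed under extensions, cokernels of monomorphisms,
infinite products, and (transfinitely) iterated extensions in the sense of the projective limit.
(Closure under isomorphisms follows: the zero module is an empty product, and a module isomorphic
to `M` is an extension of the zero module and `M`.) -/
inductive SimplyRightObtainable {R : Type u} [CommRing R]
    (E : ∀ (M : Type u) [AddCommGroup M] [Module R M], Prop) :
    ∀ (M : Type u) [AddCommGroup M] [Module R M], Prop
  | of {M : Type u} [AddCommGroup M] [Module R M] (h : E M) : SimplyRightObtainable E M
  | extension {A B C : Type u} [AddCommGroup A] [Module R A] [AddCommGroup B] [Module R B]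
      [AddCommGroup C] [Module R C] (f : A →ₗ[R] B) (g : B →ₗ[R] C)
      (hf : Function.Injective f) (hfg : Function.Exact f g) (hg : Function.Surjective g)
      (hA : SimplyRightObtainable E A) (hC : SimplyRightObtainable E C) :
      SimplyRightObtainable E B
  | cokernel {A B C : Type u} [AddCommGroup A] [Module R A] [AddCommGroup B] [Module R B]
      [AddCommGroup C] [Module R C] (f : A →ₗ[R] B) (g : B →ₗ[R] C)
      (hf : Function.Injective f) (hfg : Function.Exact f g) (hg : Function.Surjective g)
      (hA : SimplyRightObtainable E A) (hB : SimplyRightObtainable E B) :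
      SimplyRightObtainable E C
  | product {ι : Type u} (M : ι → Type u) [∀ i, AddCommGroup (M i)] [∀ i, Module R (M i)]
      (h : ∀ i, SimplyRightObtainable E (M i)) : SimplyRightObtainable E (∀ i, M i)
  | iterated (δ : Ordinal.{u}) (M : Ordinal.{u} → Type u) [∀ i, AddCommGroup (M i)]
      [∀ i, Module R (M i)] (f : ∀ i j : Ordinal.{u}, i ≤ j → (M j →ₗ[R] M i))
      (hM : IsProjIteratedExtension δ M f)
      (h : ∀ i, i < δ →
        SimplyRightObtainable E (LinearMap.ker (f i (Order.succ i) (Order.le_succ i)))) :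
      SimplyRightObtainable E (M δ)

/-! Obtainable modules are contramodules. `U` is flat and its reductions modulo ideals of the
Gabriel filter `G` vanish, so it lies in the class of flat modules with projective reductions. That
class is closed under syzygies, which turns second Ext groups into first ones and allows an
induction on obtainability (`SimplyRightObtainable.extOneVanishes`): projective reductions give the
vanishing of Ext on modules over `R ⧸ I`, syzygies handle cokernels, and a dual Eklof argument
handles transfinite iterated extensions. Vanishing of Hom follows by a second induction.

Conversely, a module without `G`-torsion on which every ideal of `G` acts as the unit ideal is a
`U`-module, so a contramodule `C` is orthogonal to it in Hom and Ext. Hence `Hom(-, C)` inverts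
every map whose kernel and cokernel are of this kind (`IsUContramodule.existsUnique_extension`). Two
such maps are `R → ∏ R_m` and `⨁ R_m → ∏ R_m`, over the maximal ideals `m` in `G`; they give `C ≅ ∏
Hom(R_m, C)`. A third, the identity minus `s` times the shift on a countable direct sum of copies of
`R_m`, shows that each factor is an `s`-contramodule for every `s ∈ m`.

Some finitely generated ideal in `G` lies inside `m`. Its generators `s` are treated one at a time:
an `s`-contramodule is an extension of its `s`-adic completion, an iterated extension of the
quotients `s^n C / s^(n+1) C`, by `⋂ s^n C`, the cokernel of an injective endomorphism of `∏ ker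
s^n`. Every building block is killed by a power of `s` and stays a contramodule for the other
generators. Once all generators act nilpotently, the annihilator is in `G`. -/

/-! ### Vanishing of Ext in degree one through projective presentations -/

section ExtOne

open CategoryTheory

variable {R : Type u} [CommRing R]

/-- Every homomorphism to `C` from the kernel of an epimorphism from a projective module onto `X`
extends to the projective module; this expresses the vanishing of `Ext^1_R(X, C)`. -/
def ExtOneVanishes (R : Type u) [CommRing R] (X C : Type u) [AddCommGroup X] [Module R X]
    [AddCommGroup C] [Module R C] : Prop :=
  ∀ (P : Type u) [AddCommGroup P] [Module R P] [Module.Projective R P] (g : P →ₗ[R] X),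
    Function.Surjective g → ∀ h : LinearMap.ker g →ₗ[R] C,
      ∃ k : P →ₗ[R] C, k ∘ₗ (LinearMap.ker g).subtype = h

variable {X C : Type u} [AddCommGroup X] [Module R X] [AddCommGroup C] [Module R C]

/-- In a free presentation every class is the image of a map from the kernel under the connecting
homomorphism; a map that extends to the free module goes to zero. -/
theorem ExtOneVanishes.subsingleton_ext (h : ExtOneVanishes R X C) :
    Subsingleton (Abelian.Ext (ModuleCat.of R X) (ModuleCat.of R C) 1) := by
  refine subsingleton_of_forall_eq 0 fun e => ?_
  let g : (X →₀ R) →ₗ[R] X := Finsupp.linearCombination R id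
  have hg : Function.Surjective g := Finsupp.linearCombination_surjective _ Function.surjective_id
  have hS := LinearMap.shortExact_shortComplexKer hg
  obtain ⟨e₁, he₁⟩ := Abelian.Ext.contravariant_sequence_exact₃ hS (ModuleCat.of R C) e
    (Abelian.Ext.eq_zero_of_projective _) (add_comm 1 0)
  obtain ⟨f, rfl⟩ := Abelian.Ext.homEquiv₀.symm.surjective e₁
  obtain ⟨k, hk⟩ := h _ g hg f.hom
  have : f = g.shortComplexKer.f ≫ ModuleCat.ofHom k := by
    ext x
    exact (LinearMap.congr_fun hk x).symm
  rw [← he₁, this]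
  change hS.extClass.comp (Abelian.Ext.mk₀ _) _ = 0
  rw [← Abelian.Ext.mk₀_comp_mk₀, ← Abelian.Ext.comp_assoc_of_second_deg_zero,
    hS.extClass_comp, Abelian.Ext.zero_comp]

theorem exists_lift_of_subsingleton_ext
    (h : Subsingleton (Abelian.Ext (ModuleCat.of R X) (ModuleCat.of R C) 1))
    {E Q : Type u} [AddCommGroup E] [Module R E] [AddCommGroup Q] [Module R Q]
    {i : C →ₗ[R] E} {p : E →ₗ[R] Q} (hi : Function.Injective i) (hp : Function.Surjective p)
    (hip : Function.Exact i p) (g : X →ₗ[R] Q) : ∃ k : X →ₗ[R] E, p ∘ₗ k = g := by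
  let S : ShortComplex (ModuleCat.{u} R) := ShortComplex.mk (ModuleCat.ofHom i)
    (ModuleCat.ofHom p) (by ext x; exact hip.apply_apply_eq_zero x)
  have hS : S.ShortExact :=
    { exact := (ShortComplex.ShortExact.moduleCat_exact_iff_function_exact S).2 hip
      mono_f := (ModuleCat.mono_iff_injective _).2 hi
      epi_g := (ModuleCat.epi_iff_surjective _).2 hp }
  obtain ⟨e, he⟩ := Abelian.Ext.covariant_sequence_exact₃ (ModuleCat.of R X) hS
    (Abelian.Ext.mk₀ (ModuleCat.ofHom g)) (zero_add 1) (Subsingleton.elim _ _)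
  obtain ⟨f, rfl⟩ := Abelian.Ext.homEquiv₀.symm.surjective e
  refine ⟨f.hom, ?_⟩
  change (Abelian.Ext.mk₀ f).comp (Abelian.Ext.mk₀ S.g) _ = _ at he
  rw [Abelian.Ext.mk₀_comp_mk₀] at he
  have := (Abelian.Ext.mk₀_bijective _ _).1 he
  exact congrArg ModuleCat.Hom.hom this

end ExtOne

/-! ### Hom and Ext into transfinite iterated extensions -/

section ClosureProperties

variable {R : Type u} [CommRing R]

theorem exists_compatible_map_of_forall_lt {δ : Ordinal.{u}} {M : Ordinal.{u} → Type u}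
    [∀ i, AddCommGroup (M i)] [∀ i, Module R (M i)]
    {f : ∀ i j : Ordinal.{u}, i ≤ j → (M j →ₗ[R] M i)} (hM : IsProjIteratedExtension δ M f)
    {P : Type u} [AddCommGroup P] [Module R P] {j : Ordinal.{u}} (hj : j ≤ δ)
    (hlim : Order.IsSuccLimit j) (k : ∀ i : Set.Iio j, P →ₗ[R] M i)
    (hk : ∀ (i l : Set.Iio j) (hil : (i : Ordinal.{u}) ≤ l), f i l hil ∘ₗ k l = k i) :
    ∃ K : P →ₗ[R] M j, ∀ i : Set.Iio j, f i j (le_of_lt i.2) ∘ₗ K = k i := by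
  have key := fun p : P => hM.limit j hj hlim (fun i => k i p)
    (fun i l hil => LinearMap.congr_fun (hk i l hil) p)
  choose K hK hKu using key
  refine ⟨{ toFun := K, map_add' := fun p q => ?_, map_smul' := fun r p => ?_ }, ?_⟩
  · exact (hKu (p + q) _ fun i => by simp [hK p i, hK q i]).symm
  · exact (hKu (r • p) _ fun i => by simp [hK p i]).symm
  · intro i
    ext p
    exact hK p i

theorem eq_zero_of_forall_lt {δ : Ordinal.{u}} {M : Ordinal.{u} → Type u}
    [∀ i, AddCommGroup (M i)] [∀ i, Module R (M i)]
    {f : ∀ i j : Ordinal.{u}, i ≤ j → (M j →ₗ[R] M i)} (hM : IsProjIteratedExtension δ M f)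
    {j : Ordinal.{u}} (hj : j ≤ δ) (hlim : Order.IsSuccLimit j) {y : M j}
    (hy : ∀ i (hi : i < j), f i j hi.le y = 0) : y = 0 :=
  (hM.limit j hj hlim (fun _ => 0) (fun _ _ _ => map_zero _)).unique (fun i => hy i i.2)
    (fun _ => map_zero _)

theorem IsProjIteratedExtension.linearMap_eq_zero {δ : Ordinal.{u}} {M : Ordinal.{u} → Type u}
    [∀ i, AddCommGroup (M i)] [∀ i, Module R (M i)]
    {f : ∀ i j : Ordinal.{u}, i ≤ j → (M j →ₗ[R] M i)} (hM : IsProjIteratedExtension δ M f)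
    {X : Type u} [AddCommGroup X] [Module R X]
    (h : ∀ i, i < δ → ∀ φ : X →ₗ[R] LinearMap.ker (f i (Order.succ i) (Order.le_succ i)), φ = 0)
    (φ : X →ₗ[R] M δ) : φ = 0 := by
  have key : ∀ (j : Ordinal.{u}) (hj : j ≤ δ), ∀ x, f j δ hj (φ x) = 0 := by
    intro j
    induction j using Ordinal.limitRecOn with
    | zero => intro hj x; exact @Subsingleton.elim _ hM.zero _ _
    | add_one i ih =>
      intro hj x
      replace hj : Order.succ i ≤ δ := hj
      have hlt : i < δ := (Order.lt_succ i).trans_le hj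
      have hz := h i hlt ((f (Order.succ i) δ hj ∘ₗ φ).codRestrict _ fun x => by
        rw [LinearMap.mem_ker, LinearMap.comp_apply, hM.map_comp _ _ _ _ _ le_rfl]
        exact ih hlt.le x)
      exact congrArg Subtype.val (LinearMap.congr_fun hz x)
    | limit j hlim ih =>
      intro hj x
      refine eq_zero_of_forall_lt hM hj hlim fun i hi => ?_
      rw [hM.map_comp _ _ _ _ _ le_rfl]
      exact ih i hi _ x
  ext x
  simpa [hM.map_id δ le_rfl] using key δ le_rfl x

/-- The dual of Eklof's lemma. Zorn's lemma is applied to partial solutions: an index `i ≤ δ` with a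
map `P → M i` extending the image of `h` there. A maximal one must sit at `δ`. -/
theorem IsProjIteratedExtension.extOneVanishes {δ : Ordinal.{u}} {M : Ordinal.{u} → Type u}
    [∀ i, AddCommGroup (M i)] [∀ i, Module R (M i)]
    {f : ∀ i j : Ordinal.{u}, i ≤ j → (M j →ₗ[R] M i)} (hM : IsProjIteratedExtension δ M f)
    {X : Type u} [AddCommGroup X] [Module R X]
    (hX : ∀ i, i < δ →
      ExtOneVanishes R X (LinearMap.ker (f i (Order.succ i) (Order.le_succ i)))) :
    ExtOneVanishes R X (M δ) := by
  intro P _ _ _ g hg h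
  let S := {a : (Σ i : {i // i ≤ δ}, (P →ₗ[R] M i)) //
    a.2 ∘ₗ (LinearMap.ker g).subtype = f a.1 δ a.1.2 ∘ₗ h}
  let r : S → S → Prop := fun a b => ∃ hab : (a.1.1 : Ordinal.{u}) ≤ b.1.1,
    f a.1.1 b.1.1 hab ∘ₗ b.1.2 = a.1.2
  have hrefl : ∀ a, r a a := fun a => ⟨le_rfl, by ext x; exact hM.map_id _ a.1.1.2 _⟩
  have : Std.Refl r := ⟨hrefl⟩
  have htrans : ∀ {a b c}, r a b → r b c → r a c := by
    rintro a b c ⟨hab, h1⟩ ⟨hbc, h2⟩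
    refine ⟨hab.trans hbc, ?_⟩
    rw [← h1, ← h2]
    ext x
    exact (hM.map_comp _ _ _ hab hbc c.1.1.2 _).symm
  obtain ⟨a, ha⟩ : ∃ a, ∀ b, r a b → r b a := by
    refine exists_maximal_of_chains_bounded (fun c hc => ?_) htrans
    rcases c.eq_empty_or_nonempty with rfl | ⟨a₀, ha₀⟩
    · have := hM.zero
      exact ⟨⟨⟨⟨0, zero_le⟩, 0⟩, by ext; exact Subsingleton.elim _ _⟩, by simp⟩
    -- If a largest index is attained, that element bounds the chain, because members with equal
    -- index coincide. Otherwise the supremum of the indices is a limit ordinal, and the maps glue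
    -- there.
    by_cases hmax : ∃ b ∈ c, ∀ a ∈ c, a.1.1 ≤ b.1.1
    · obtain ⟨b, hb, hmax⟩ := hmax
      refine ⟨b, fun a hac => ?_⟩
      rcases hc.total hac hb with h1 | ⟨h1, h2⟩
      · exact h1
      · have heq : a.1.1 = b.1.1 := le_antisymm (hmax a hac) h1
        obtain ⟨⟨i, ka⟩, hka⟩ := a
        obtain ⟨⟨i', kb⟩, hkb⟩ := b
        obtain rfl : i = i' := heq
        refine ⟨le_rfl, ?_⟩
        change f i i le_rfl ∘ₗ ka = kb at h2
        have e1 : f i i le_rfl ∘ₗ ka = ka := by ext x; exact hM.map_id _ i.2 _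
        have e2 : f i i le_rfl ∘ₗ kb = kb := by ext x; exact hM.map_id _ i.2 _
        change f i i le_rfl ∘ₗ kb = ka
        rw [e2, ← h2, e1]
    push Not at hmax
    let J : Set Ordinal.{u} := (fun a : S => (a.1.1 : Ordinal.{u})) '' c
    have hJ : BddAbove J := ⟨δ, by rintro _ ⟨a, _, rfl⟩; exact a.1.1.2⟩
    let j := sSup J
    have hjδ : j ≤ δ := csSup_le ⟨_, a₀, ha₀, rfl⟩ (by rintro _ ⟨a, _, rfl⟩; exact a.1.1.2)
    have hlt : ∀ a ∈ c, (a.1.1 : Ordinal.{u}) < j := fun a hac => by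
      obtain ⟨b, hb, hab⟩ := hmax a hac
      exact lt_of_lt_of_le hab (le_csSup hJ ⟨b, hb, rfl⟩)
    have hex : ∀ i : Set.Iio j, ∃ a ∈ c, (i : Ordinal.{u}) < a.1.1 := fun i => by
      obtain ⟨_, ⟨a, hac, rfl⟩, hia⟩ := exists_lt_of_lt_csSup (s := J) ⟨_, a₀, ha₀, rfl⟩ i.2
      exact ⟨a, hac, hia⟩
    have hlim : Order.IsSuccLimit j := by
      refine (Order.isSuccLimit_iff j).2 ⟨fun hmin => ?_, fun i hi => ?_⟩
      · exact hmin.not_lt (hlt a₀ ha₀)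
      · obtain ⟨a, hac, hia⟩ := hex ⟨i, hi.lt⟩
        exact hi.2 hia (hlt a hac)
    choose A hAc hA using hex
    let k : ∀ i : Set.Iio j, P →ₗ[R] M i := fun i => f i (A i).1.1 (hA i).le ∘ₗ (A i).1.2
    have hkA : ∀ (i : Set.Iio j) (a : S), a ∈ c → ∀ hia : (i : Ordinal.{u}) ≤ a.1.1,
        f i a.1.1 hia ∘ₗ a.1.2 = k i := by
      intro i a hac hia
      rcases hc.total hac (hAc i) with ⟨h1, h2⟩ | ⟨h1, h2⟩
      · rw [← h2]
        ext x
        exact hM.map_comp _ _ _ hia h1 (A i).1.1.2 _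
      · change _ = f i (A i).1.1 (hA i).le ∘ₗ (A i).1.2
        rw [← h2]
        ext x
        exact (hM.map_comp _ _ _ (hA i).le h1 a.1.1.2 _).symm
    obtain ⟨K, hK⟩ := exists_compatible_map_of_forall_lt hM hjδ hlim k (fun i l hil => by
      rw [← hkA i (A l) (hAc l) (hil.trans (hA l).le)]
      ext x
      exact hM.map_comp _ _ _ hil (hA l).le (A l).1.1.2 _)
    refine ⟨⟨⟨⟨j, hjδ⟩, K⟩, ?_⟩, fun a hac => ⟨(hlt a hac).le, ?_⟩⟩
    · ext x
      refine sub_eq_zero.1 (eq_zero_of_forall_lt hM hjδ hlim fun i hi => ?_)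
      have e1 := LinearMap.congr_fun (hK ⟨i, hi⟩) x
      have e2 := LinearMap.congr_fun (A ⟨i, hi⟩).2 x
      simp only [LinearMap.comp_apply, Submodule.subtype_apply] at e1 e2
      rw [map_sub, sub_eq_zero]
      simp only [LinearMap.comp_apply, Submodule.subtype_apply]
      rw [e1]
      change f i _ _ ((A ⟨i, hi⟩).1.2 x) = _
      rw [e2, hM.map_comp _ _ _ _ _ le_rfl, hM.map_comp _ _ _ _ _ le_rfl]
    · rw [hK ⟨a.1.1, hlt a hac⟩, ← hkA ⟨a.1.1, hlt a hac⟩ a hac le_rfl]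
      ext x
      exact hM.map_id _ a.1.1.2 _
  obtain ⟨⟨⟨i, hi⟩, k⟩, hk⟩ := a
  change P →ₗ[R] M i at k
  change k ∘ₗ (LinearMap.ker g).subtype = f i δ hi ∘ₗ h at hk
  rcases (show i ≤ δ from hi).lt_or_eq with hlt | rfl
  swap
  · refine ⟨k, hk.trans ?_⟩
    ext x
    exact hM.map_id _ le_rfl _
  exfalso
  have hs : Order.succ i ≤ δ := Order.succ_le_iff.2 hlt
  -- The lift `k'` to the next stage may miss `h` on `ker g`, but the error `d` lands in the kernel
  -- of the successor map, so it extends to `P` and can be added to `k'`.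
  obtain ⟨k', hk'⟩ := Module.projective_lifting_property (f i (Order.succ i) (Order.le_succ i)) k
    (hM.succ i hlt)
  let d : LinearMap.ker g →ₗ[R] LinearMap.ker (f i (Order.succ i) (Order.le_succ i)) :=
    (f (Order.succ i) δ hs ∘ₗ h - k' ∘ₗ (LinearMap.ker g).subtype).codRestrict _ fun x => by
      have e1 := LinearMap.congr_fun hk x
      have e2 := LinearMap.congr_fun hk' x
      simp only [LinearMap.comp_apply, Submodule.subtype_apply] at e1 e2
      simp only [LinearMap.mem_ker, LinearMap.sub_apply, LinearMap.comp_apply, map_sub,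
        Submodule.subtype_apply]
      rw [hM.map_comp _ _ _ _ _ le_rfl, e2, e1, sub_self]
  obtain ⟨e, he⟩ := hX i hlt P g hg d
  let b : S := ⟨⟨⟨Order.succ i, hs⟩, k' + (LinearMap.ker _).subtype ∘ₗ e⟩, by
    ext x
    have e1 := congrArg Subtype.val (LinearMap.congr_fun he x)
    simp only [LinearMap.comp_apply, Submodule.subtype_apply] at e1
    simp only [LinearMap.comp_apply, Submodule.subtype_apply, LinearMap.add_apply, e1]
    simp [d]⟩
  obtain ⟨hle, -⟩ := ha b ⟨Order.le_succ i, by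
    ext x
    have e2 := LinearMap.congr_fun hk' x
    simp only [LinearMap.comp_apply] at e2
    simp [b, e2]⟩
  exact absurd (Order.succ_le_iff.1 hle) (lt_irrefl i)

end ClosureProperties

/-! ### Flat modules with projective reductions -/

section RelativelyProjective

open TensorProduct

variable {R : Type u} [CommRing R]

/-- Flat modules whose reductions modulo all the ideals in `G` are projective. -/
structure IsFlatWithProjectiveReductions (G : Set (Ideal R)) (X : Type u) [AddCommGroup X]
    [Module R X] : Prop where
  flat : Module.Flat R X
  projective : ∀ I ∈ G, Module.Projective (R ⧸ I) ((R ⧸ I) ⊗[R] X)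

variable {G : Set (Ideal R)} {X P : Type u} [AddCommGroup X] [Module R X] [AddCommGroup P]
  [Module R P]

theorem Module.Flat.ker_of_surjective [Module.Flat R X] [Module.Flat R P] {g : P →ₗ[R] X}
    (hg : Function.Surjective g) : Module.Flat R (LinearMap.ker g) := by
  rw [Module.Flat.iff_rTensor_preserves_injective_linearMap]
  intro A B _ _ _ _ f hf
  have h1 := LinearMap.lTensor_injective_of_exact_of_flat g hg (LinearMap.ker g).subtype
    (Submodule.injective_subtype _) (LinearMap.exact_subtype_ker_map g) A
  have h2 := Module.Flat.rTensor_preserves_injective_linearMap (M := P) f hf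
  refine Function.Injective.of_comp (f := (LinearMap.ker g).subtype.lTensor B) ?_
  rw [← LinearMap.coe_comp, LinearMap.lTensor_comp_rTensor, ← LinearMap.rTensor_comp_lTensor,
    LinearMap.coe_comp]
  exact h2.comp h1

/-- Flatness of `X` keeps the presentation exact after reduction modulo `I`, and projectivity of the
reduction of `X` splits it. -/
theorem IsFlatWithProjectiveReductions.exists_retraction
    (hX : IsFlatWithProjectiveReductions G X) {g : P →ₗ[R] X} (hg : Function.Surjective g)
    {I : Ideal R} (hI : I ∈ G) :
    ∃ ρ : ((R ⧸ I) ⊗[R] P) →ₗ[R ⧸ I] ((R ⧸ I) ⊗[R] LinearMap.ker g),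
      ρ ∘ₗ (LinearMap.ker g).subtype.baseChange (R ⧸ I) = LinearMap.id := by
  have := hX.flat
  have := hX.projective I hI
  have h1 : Function.Injective ((LinearMap.ker g).subtype.baseChange (R ⧸ I)) :=
    LinearMap.lTensor_injective_of_exact_of_flat g hg (LinearMap.ker g).subtype
    (Submodule.injective_subtype _) (LinearMap.exact_subtype_ker_map g) _
  have h2 : Function.Exact ((LinearMap.ker g).subtype.baseChange (R ⧸ I))
      (g.baseChange (R ⧸ I)) := lTensor_exact _ (LinearMap.exact_subtype_ker_map g) hg
  obtain ⟨s, hs⟩ := Module.projective_lifting_property (g.baseChange (R ⧸ I)) LinearMap.id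
    (LinearMap.lTensor_surjective _ hg)
  have h3 := h2.split_tfae'.out 0 1
  exact (h3.1 ⟨h1, s, hs⟩).2

theorem IsFlatWithProjectiveReductions.ker (hX : IsFlatWithProjectiveReductions G X)
    [Module.Projective R P] {g : P →ₗ[R] X} (hg : Function.Surjective g) :
    IsFlatWithProjectiveReductions G (LinearMap.ker g) where
  flat := have := hX.flat; Module.Flat.ker_of_surjective hg
  projective I hI := by
    obtain ⟨ρ, hρ⟩ := hX.exists_retraction hg hI
    exact Module.Projective.of_split _ ρ hρ

theorem IsFlatWithProjectiveReductions.extOneVanishes_of_isQuotientRingModule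
    (hX : IsFlatWithProjectiveReductions G X) {M : Type u} [AddCommGroup M] [Module R M]
    (hM : IsQuotientRingModule G M) : ExtOneVanishes R X M := by
  intro P _ _ _ g hg h
  obtain ⟨I, hI, _, _⟩ := hM
  obtain ⟨ρ, hρ⟩ := hX.exists_retraction hg hI
  refine ⟨((h.liftBaseChange (R ⧸ I)) ∘ₗ ρ).restrictScalars R ∘ₗ
    TensorProduct.mk R (R ⧸ I) P 1, ?_⟩
  ext x
  have := LinearMap.congr_fun hρ (1 ⊗ₜ x)
  simp only [LinearMap.comp_apply, LinearMap.baseChange_tmul, LinearMap.id_apply] at this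
  simp only [LinearMap.comp_apply, LinearMap.restrictScalars_apply, TensorProduct.mk_apply, this]
  simp

theorem LinearMap.exists_comp_eq_of_forall_mem_range {A B : Type*} [AddCommGroup A] [Module R A]
    [AddCommGroup B] [Module R B] {Y : Type*} [AddCommGroup Y] [Module R Y]
    {f : A →ₗ[R] B} (hf : Function.Injective f) {h : Y →ₗ[R] B}
    (hh : ∀ x, h x ∈ LinearMap.range f) : ∃ k : Y →ₗ[R] A, ∀ x, f (k x) = h x :=
  ⟨(LinearEquiv.ofInjective f hf).symm.toLinearMap ∘ₗ h.codRestrict (LinearMap.range f) hh,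
    fun x => by simp⟩

theorem ExtOneVanishes.extension {A B C : Type u} [AddCommGroup A] [Module R A] [AddCommGroup B]
    [Module R B] [AddCommGroup C] [Module R C] {f : A →ₗ[R] B} {g : B →ₗ[R] C}
    (hf : Function.Injective f) (hfg : Function.Exact f g) (hg : Function.Surjective g)
    (hA : ExtOneVanishes R X A) (hC : ExtOneVanishes R X C) : ExtOneVanishes R X B := by
  intro P _ _ _ p hp h
  obtain ⟨k, hk⟩ := hC P p hp (g ∘ₗ h)
  obtain ⟨k', hk'⟩ := Module.projective_lifting_property g k hg
  have hd : ∀ x, h x - k' x ∈ LinearMap.range f := fun x => by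
    have e1 := LinearMap.congr_fun hk x
    have e2 := LinearMap.congr_fun hk' x
    simp only [LinearMap.comp_apply, Submodule.subtype_apply] at e1 e2
    exact (hfg _).1 (by rw [map_sub, e2, e1, sub_self])
  obtain ⟨d, hd⟩ := LinearMap.exists_comp_eq_of_forall_mem_range hf
    (h := h - k' ∘ₗ (LinearMap.ker p).subtype) hd
  obtain ⟨e, he⟩ := hA P p hp d
  refine ⟨k' + f ∘ₗ e, ?_⟩
  ext x
  have e1 := congrArg f (LinearMap.congr_fun he x)
  simp only [LinearMap.comp_apply, Submodule.subtype_apply] at e1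
  simp [e1, hd]

/-- The hypothesis on `A` encodes the vanishing of the second Ext group by dimension shifting: it
lets `h` lift from `C` to a map `l` into `B`, which then extends to `P`. -/
theorem ExtOneVanishes.cokernel {A B C : Type u} [AddCommGroup A] [Module R A] [AddCommGroup B]
    [Module R B] [AddCommGroup C] [Module R C] {f : A →ₗ[R] B} {g : B →ₗ[R] C}
    (hf : Function.Injective f) (hfg : Function.Exact f g) (hg : Function.Surjective g)
    (hA : ∀ (P : Type u) [AddCommGroup P] [Module R P] [Module.Projective R P] (p : P →ₗ[R] X),
      Function.Surjective p → ExtOneVanishes R (LinearMap.ker p) A)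
    (hB : ExtOneVanishes R X B) : ExtOneVanishes R X C := by
  intro P _ _ _ p hp h
  let q : (LinearMap.ker p →₀ R) →ₗ[R] LinearMap.ker p := Finsupp.linearCombination R id
  have hq : Function.Surjective q := Finsupp.linearCombination_surjective _ Function.surjective_id
  obtain ⟨k, hk⟩ := Module.projective_lifting_property g (h ∘ₗ q) hg
  have hd : ∀ x : LinearMap.ker q, k x ∈ LinearMap.range f := fun x => by
    refine (hfg _).1 ?_
    have := LinearMap.congr_fun hk x
    simp only [LinearMap.comp_apply] at this
    rw [this, LinearMap.mem_ker.1 x.2, map_zero]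
  obtain ⟨d, hd⟩ := LinearMap.exists_comp_eq_of_forall_mem_range hf
    (h := k ∘ₗ (LinearMap.ker q).subtype) fun x => hd x
  obtain ⟨e, he⟩ := hA P p hp _ q hq d
  let l : LinearMap.ker p →ₗ[R] B := ((LinearMap.ker q).liftQ (k - f ∘ₗ e) fun x hx => by
    have e1 := congrArg f (LinearMap.congr_fun he ⟨x, hx⟩)
    simp only [LinearMap.comp_apply, Submodule.subtype_apply] at e1
    simp [e1, hd]) ∘ₗ (q.quotKerEquivOfSurjective hq).symm.toLinearMap
  have hl : ∀ y, l (q y) = k y - f (e y) := fun y => by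
    have : (q.quotKerEquivOfSurjective hq).symm (q y) = Submodule.Quotient.mk y := by
      rw [LinearEquiv.symm_apply_eq]; rfl
    simp [l, this]
  obtain ⟨L, hL⟩ := hB P p hp l
  refine ⟨g ∘ₗ L, ?_⟩
  ext x
  obtain ⟨y, rfl⟩ := hq x
  have e1 := LinearMap.congr_fun hL (q y)
  have e2 := LinearMap.congr_fun hk y
  simp only [LinearMap.comp_apply, Submodule.subtype_apply] at e1 e2 ⊢
  rw [e1, hl, map_sub, hfg.apply_apply_eq_zero, sub_zero, e2]

theorem ExtOneVanishes.pi {ι : Type u} {M : ι → Type u} [∀ i, AddCommGroup (M i)]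
    [∀ i, Module R (M i)] (h : ∀ i, ExtOneVanishes R X (M i)) :
    ExtOneVanishes R X (∀ i, M i) := by
  intro P _ _ _ p hp k
  choose e he using fun i => h i P p hp (LinearMap.proj i ∘ₗ k)
  refine ⟨LinearMap.pi e, ?_⟩
  ext x i
  exact LinearMap.congr_fun (he i) x

/-- `X` is quantified inside the induction because the cokernel case replaces it by a syzygy. -/
theorem SimplyRightObtainable.extOneVanishes
    {E : ∀ (M : Type u) [AddCommGroup M] [Module R M], Prop}
    (hE : ∀ (M : Type u) [AddCommGroup M] [Module R M], E M → IsQuotientRingModule G M)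
    {C : Type u} [AddCommGroup C] [Module R C] (hC : SimplyRightObtainable E C) :
    ∀ (X : Type u) [AddCommGroup X] [Module R X], IsFlatWithProjectiveReductions G X →
      ExtOneVanishes R X C := by
  induction hC with
  | of h => exact fun X _ _ hX => hX.extOneVanishes_of_isQuotientRingModule (hE _ h)
  | extension f g hf hfg hg _ _ hA hC =>
    exact fun X _ _ hX => ExtOneVanishes.extension hf hfg hg (hA X hX) (hC X hX)
  | cokernel f g hf hfg hg _ _ hA hB =>
    exact fun X _ _ hX => ExtOneVanishes.cokernel hf hfg hg
      (fun P _ _ _ p hp => hA _ (hX.ker hp)) (hB X hX)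
  | product M _ h => exact fun X _ _ hX => ExtOneVanishes.pi fun i => h i X hX
  | iterated δ M f hM _ h => exact fun X _ _ hX => hM.extOneVanishes fun i hi => h i hi X hX

theorem SimplyRightObtainable.linearMap_eq_zero
    {E : ∀ (M : Type u) [AddCommGroup M] [Module R M], Prop}
    (hE : ∀ (M : Type u) [AddCommGroup M] [Module R M], E M → IsQuotientRingModule G M)
    {C : Type u} [AddCommGroup C] [Module R C] (hC : SimplyRightObtainable E C)
    (hX : IsFlatWithProjectiveReductions G X)
    (hX0 : ∀ I ∈ G, Subsingleton ((R ⧸ I) ⊗[R] X)) (φ : X →ₗ[R] C) : φ = 0 := by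
  induction hC with
  | of h =>
    obtain ⟨I, hI, _, _⟩ := hE _ h
    have := hX0 I hI
    ext x
    have : φ.liftBaseChange (R ⧸ I) (1 ⊗ₜ x) = φ.liftBaseChange (R ⧸ I) 0 :=
      congrArg _ (Subsingleton.elim _ _)
    simpa using this
  | extension f g hf hfg hg _ _ hA hC =>
    have h0 : ∀ x, φ x ∈ LinearMap.range f := fun x =>
      (hfg _).1 (LinearMap.congr_fun (hC (g ∘ₗ φ)) x)
    obtain ⟨k, hk⟩ := LinearMap.exists_comp_eq_of_forall_mem_range hf h0
    ext x
    rw [← hk, hA k, LinearMap.zero_apply, LinearMap.zero_apply, map_zero]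
  | @cokernel A B C _ _ _ _ _ _ f g hf hfg hg hA hB _ ih =>
    -- A map into a cokernel lifts to the middle term since Ext from `X` to `A` vanishes; the lift
    -- is zero by induction.
    obtain ⟨k, rfl⟩ := exists_lift_of_subsingleton_ext
      (hA.extOneVanishes hE X hX).subsingleton_ext hf hg hfg φ
    rw [ih k, LinearMap.comp_zero]
  | product M _ h =>
    ext x i
    exact LinearMap.congr_fun (h i (LinearMap.proj i ∘ₗ φ)) x
  | iterated δ M f hM _ h => exact hM.linearMap_eq_zero h φ

end RelativelyProjective

theorem isFlatWithProjectiveReductions_gabrielFilter (R U : Type u) [CommRing R] [CommRing U]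
    [Algebra R U] [Module.Flat R U] : IsFlatWithProjectiveReductions (gabrielFilter R U) U where
  flat := inferInstance
  projective I hI := by
    have : Subsingleton (TensorProduct R (R ⧸ I) U) := hI
    infer_instance

theorem SimplyRightObtainable.isUContramodule {R U : Type u} [CommRing R] [CommRing U]
    [Algebra R U] [Module.Flat R U] {C : Type u} [AddCommGroup C] [Module R C]
    (hC : SimplyRightObtainable (R := R)
      (fun M [AddCommGroup M] [Module R M] => IsQuotientRingModule (gabrielFilter R U) M) C) :
    IsUContramodule R U C :=
  ⟨subsingleton_of_forall_eq 0 (hC.linearMap_eq_zero (fun _ _ _ h => h)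
    (isFlatWithProjectiveReductions_gabrielFilter R U) fun _ hI => hI),
    (hC.extOneVanishes (fun _ _ _ h => h) U
      (isFlatWithProjectiveReductions_gabrielFilter R U)).subsingleton_ext⟩

/-! ### The Gabriel filter and modules with a `U`-action -/

section GabrielFilter

open TensorProduct

variable {R U : Type u} [CommRing R] [CommRing U] [Algebra R U]

theorem mem_gabrielFilter_iff {I : Ideal R} :
    I ∈ gabrielFilter R U ↔ I.map (algebraMap R U) = ⊤ := by
  change Subsingleton _ ↔ _
  rw [(TensorProduct.quotTensorEquivQuotSMul U I).toEquiv.subsingleton_congr,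
    Submodule.Quotient.subsingleton_iff, Ideal.smul_top_eq_map, Submodule.restrictScalars_eq_top_iff]

theorem gabrielFilter_mono {I J : Ideal R} (h : I ≤ J) (hI : I ∈ gabrielFilter R U) :
    J ∈ gabrielFilter R U := by
  rw [mem_gabrielFilter_iff] at hI ⊢
  exact top_le_iff.1 (hI ▸ Ideal.map_mono h)

theorem pow_mem_gabrielFilter {I : Ideal R} (hI : I ∈ gabrielFilter R U) (n : ℕ) :
    I ^ n ∈ gabrielFilter R U := by
  rw [mem_gabrielFilter_iff] at hI ⊢
  rw [Ideal.map_pow, hI, Ideal.top_pow]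

theorem exists_finset_span_mem_gabrielFilter {I : Ideal R} (hI : I ∈ gabrielFilter R U) :
    ∃ t : Finset R, (t : Set R) ⊆ I ∧ Ideal.span (t : Set R) ∈ gabrielFilter R U := by
  classical
  rw [mem_gabrielFilter_iff, Ideal.eq_top_iff_one, Ideal.map] at hI
  obtain ⟨s, hs, h1⟩ := Submodule.mem_span_finite_of_mem_span hI
  obtain ⟨t, ht, rfl⟩ := Finset.subset_set_image_iff.1 hs
  refine ⟨t, ht, ?_⟩
  rw [mem_gabrielFilter_iff, Ideal.eq_top_iff_one, Ideal.map_span]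
  simpa using h1

/-- The cyclic submodule generated by `x` is `R ⧸ I` with `I` its annihilator. By flatness its
tensor product with `U` embeds in `X ⊗ U`, where its image is zero. -/
theorem exists_annihilator_mem_gabrielFilter [Module.Flat R U] {X : Type u} [AddCommGroup X]
    [Module R X] {x : X} (h : ∀ z : U, x ⊗ₜ[R] z = 0) :
    ∃ I ∈ gabrielFilter R U, ∀ i ∈ I, i • x = 0 := by
  refine ⟨LinearMap.ker (LinearMap.toSpanSingleton R X x), ?_, fun i hi => hi⟩
  set I : Ideal R := LinearMap.ker (LinearMap.toSpanSingleton R X x) with hI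
  let q : (R ⧸ I) →ₗ[R] X := I.liftQ (LinearMap.toSpanSingleton R X x) le_rfl
  have hq : Function.Injective q :=
    LinearMap.ker_eq_bot.1 (Submodule.ker_liftQ_eq_bot _ _ _ le_rfl)
  have h1 := Module.Flat.rTensor_preserves_injective_linearMap (M := U) q hq
  have h0 : q.rTensor U = 0 := by
    ext z
    have : q 1 = x := one_smul R x
    simp [this, h]
  refine ⟨fun a b => h1 ?_⟩
  rw [h0, LinearMap.zero_apply, LinearMap.zero_apply]

/-- The cokernel of `R → U` dies after tensoring with `U`, since `z ⊗ w = 1 ⊗ w z` for an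
epimorphism; hence it is `G`-torsion. -/
theorem exists_smul_mem_range [Module.Flat R U] [Algebra.IsEpi R U] (z : U) :
    ∃ I ∈ gabrielFilter R U, ∀ i ∈ I, ∃ r : R, i • z = algebraMap R U r := by
  have h : ∀ w : U, (LinearMap.range (Algebra.linearMap R U)).mkQ z ⊗ₜ[R] w = 0 := by
    intro w
    have e1 : (z ⊗ₜ[R] w : U ⊗[R] U) = 1 ⊗ₜ (w * z) := by
      have := (Algebra.isEpi_iff_forall_one_tmul_eq R U).1 inferInstance z
      have e := congrArg (fun y : U ⊗[R] U => (1 ⊗ₜ[R] w) * y) this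
      simpa using e.symm
    have e2 := congrArg ((LinearMap.range (Algebra.linearMap R U)).mkQ.rTensor U) e1
    rw [LinearMap.rTensor_tmul, LinearMap.rTensor_tmul] at e2
    have e3 : (LinearMap.range (Algebra.linearMap R U)).mkQ 1 = 0 :=
      (Submodule.Quotient.mk_eq_zero _).2 (LinearMap.mem_range.2 ⟨1, by simp⟩)
    rw [e2, e3, zero_tmul]
  obtain ⟨I, hI, hz⟩ := exists_annihilator_mem_gabrielFilter h
  refine ⟨I, hI, fun i hi => ?_⟩
  have := hz i hi
  rw [← map_smul, Submodule.mkQ_apply, Submodule.Quotient.mk_eq_zero] at this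
  obtain ⟨r, hr⟩ := this
  exact ⟨r, hr.symm⟩

/-- Modules without torsion with respect to `G` on which every ideal in `G` acts as the
unit ideal. -/
structure IsTorsionFreeDivisible (G : Set (Ideal R)) (X : Type u) [AddCommGroup X]
    [Module R X] : Prop where
  eq_zero : ∀ I ∈ G, ∀ x : X, (∀ i ∈ I, i • x = 0) → x = 0
  smul_top : ∀ I ∈ G, I • (⊤ : Submodule R X) = ⊤

/-- The map `X → X ⊗ U` is bijective: its kernel is `G`-torsion, and divisibility moves an ideal
that carries `z` into the image of `R` across the tensor sign. -/
theorem IsTorsionFreeDivisible.exists_action [Module.Flat R U] [Algebra.IsEpi R U]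
    {X : Type u} [AddCommGroup X] [Module R X]
    (hX : IsTorsionFreeDivisible (gabrielFilter R U) X) :
    ∃ a : X →ₗ[R] U →ₗ[R] X, ∀ x, a x 1 = x := by
  let m : X →ₗ[R] X ⊗[R] U := (TensorProduct.mk R X U).flip 1
  have hinj : Function.Injective m := by
    rw [injective_iff_map_eq_zero]
    intro x hx
    have : ∀ z : U, x ⊗ₜ[R] z = 0 := fun z => by
      have e := congrArg ((LinearMap.mulLeft R z).lTensor X) hx
      simpa [m] using e
    obtain ⟨I, hI, h⟩ := exists_annihilator_mem_gabrielFilter this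
    exact hX.eq_zero I hI x h
  have hsurj : Function.Surjective m := by
    rw [← LinearMap.range_eq_top, eq_top_iff]
    intro y _
    induction y using TensorProduct.induction_on with
    | zero => exact zero_mem _
    | add y z hy hz => exact add_mem (hy trivial) (hz trivial)
    | tmul x z =>
      obtain ⟨I, hI, hz⟩ := exists_smul_mem_range (R := R) z
      have hx : x ∈ I • (⊤ : Submodule R X) := by rw [hX.smul_top I hI]; trivial
      refine Submodule.smul_induction_on hx (fun i hi x _ => ?_) fun x y hx hy => ?_
      · obtain ⟨r, hr⟩ := hz i hi
        refine ⟨r • x, ?_⟩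
        rw [TensorProduct.smul_tmul, hr, Algebra.algebraMap_eq_smul_one,
          TensorProduct.tmul_smul]
        simp [m]
      · rw [add_tmul]
        exact add_mem hx hy
  let e := LinearEquiv.ofBijective m ⟨hinj, hsurj⟩
  refine ⟨(TensorProduct.mk R X U).compr₂ e.symm.toLinearMap, fun x => ?_⟩
  change e.symm (x ⊗ₜ 1) = x
  rw [LinearEquiv.symm_apply_eq]
  rfl

end GabrielFilter

/-! ### Orthogonality of contramodules to torsion-free divisible modules -/

section Orthogonality

variable {R U : Type u} [CommRing R] [CommRing U] [Algebra R U] [Module.Flat R U]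
  [Algebra.IsEpi R U] {C : Type u} [AddCommGroup C] [Module R C]

theorem IsUContramodule.linearMap_eq_zero (hC : IsUContramodule R U C) {X : Type u}
    [AddCommGroup X] [Module R X] (hX : IsTorsionFreeDivisible (gabrielFilter R U) X)
    (φ : X →ₗ[R] C) : φ = 0 := by
  obtain ⟨a, ha⟩ := hX.exists_action
  have := hC.1
  ext x
  rw [← ha x]
  exact LinearMap.congr_fun (Subsingleton.elim (φ ∘ₗ a x) 0) 1

/-- For each `x` the composite `U → X → Q` lifts to `E`, uniquely because `Hom(U, C) = 0`.
Uniqueness makes the lifts linear in `x`, and evaluation at `1` gives the map. -/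
theorem IsUContramodule.exists_lift (hC : IsUContramodule R U C) {X E Q : Type u}
    [AddCommGroup X] [Module R X] (hX : IsTorsionFreeDivisible (gabrielFilter R U) X)
    [AddCommGroup E] [Module R E] [AddCommGroup Q] [Module R Q]
    {i : C →ₗ[R] E} {p : E →ₗ[R] Q} (hi : Function.Injective i) (hp : Function.Surjective p)
    (hip : Function.Exact i p) (g : X →ₗ[R] Q) : ∃ k : X →ₗ[R] E, p ∘ₗ k = g := by
  obtain ⟨a, ha⟩ := hX.exists_action
  have hsub := hC.1
  have huniq : ∀ s t : U →ₗ[R] E, p ∘ₗ s = p ∘ₗ t → s = t := fun s t hst => by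
    obtain ⟨k, hk⟩ := LinearMap.exists_comp_eq_of_forall_mem_range hi (h := s - t) fun x =>
      (hip _).1 (by
        have := LinearMap.congr_fun hst x
        simp only [LinearMap.comp_apply] at this
        simp [this])
    rw [Subsingleton.elim k 0] at hk
    ext x
    have := hk x
    rw [LinearMap.zero_apply, map_zero, LinearMap.sub_apply] at this
    exact (sub_eq_zero.1 this.symm)
  choose s hs using fun x => exists_lift_of_subsingleton_ext hC.2 hi hp hip (g ∘ₗ a x)
  have hadd : ∀ x y, s (x + y) = s x + s y := fun x y => huniq _ _ (by
    rw [hs, LinearMap.comp_add, hs, hs, map_add, LinearMap.comp_add])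
  have hsmul : ∀ (r : R) x, s (r • x) = r • s x := fun r x => huniq _ _ (by
    rw [hs, LinearMap.comp_smul, hs, map_smul, LinearMap.comp_smul])
  refine ⟨{ toFun := fun x => s x 1, map_add' := fun x y => by rw [hadd, LinearMap.add_apply],
            map_smul' := fun r x => by rw [hsmul]; rfl }, ?_⟩
  ext x
  have := LinearMap.congr_fun (hs x) 1
  simp only [LinearMap.comp_apply, ha] at this
  exact this

theorem IsUContramodule.existsUnique_extension (hC : IsUContramodule R U C) {A B : Type u}
    [AddCommGroup A] [Module R A] [AddCommGroup B] [Module R B] (f : A →ₗ[R] B)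
    (hker : IsTorsionFreeDivisible (gabrielFilter R U) (LinearMap.ker f))
    (hcoker : IsTorsionFreeDivisible (gabrielFilter R U) (B ⧸ LinearMap.range f))
    (h : A →ₗ[R] C) : ∃! k : B →ₗ[R] C, k ∘ₗ f = h := by
  have hh : ∀ a, f a = 0 → h a = 0 := fun a ha =>
    LinearMap.congr_fun (hC.linearMap_eq_zero hker (h ∘ₗ (LinearMap.ker f).subtype)) ⟨a, ha⟩
  refine existsUnique_of_exists_of_unique ?_ fun k l hk hl => ?_
  -- Existence: the pushout of `f` along `h` is an extension of `coker f` by `C`, injectivity of `i`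
  -- being due to `hh`. A splitting `σ` of it yields a retraction onto `C`, whose restriction to `B`
  -- is the extension sought.
  · let N := LinearMap.range (h.prod (-f))
    let i : C →ₗ[R] (C × B) ⧸ N := N.mkQ ∘ₗ LinearMap.inl R C B
    let p : ((C × B) ⧸ N) →ₗ[R] B ⧸ LinearMap.range f :=
      N.liftQ ((LinearMap.range f).mkQ ∘ₗ LinearMap.snd R C B) (by
        rintro _ ⟨a, rfl⟩
        simp)
    have hi : Function.Injective i := by
      rw [injective_iff_map_eq_zero]
      intro c hc
      obtain ⟨a, ha⟩ := (Submodule.Quotient.mk_eq_zero N).1 hc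
      have e1 : h a = c := congrArg Prod.fst ha
      have e2 : -f a = 0 := congrArg Prod.snd ha
      rw [← e1, hh a (neg_eq_zero.1 e2)]
    have hp : Function.Surjective p := fun y => by
      obtain ⟨b, rfl⟩ := Submodule.mkQ_surjective _ y
      exact ⟨N.mkQ (0, b), rfl⟩
    have hmk : ∀ c a, N.mkQ (c, f a) = i (c + h a) := fun c a => by
      change N.mkQ _ = N.mkQ _
      rw [← sub_eq_zero, ← map_sub]
      refine (Submodule.Quotient.mk_eq_zero N).2 ⟨-a, ?_⟩
      simp
    have hip : Function.Exact i p := by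
      intro y
      constructor
      · intro hy
        obtain ⟨⟨c, b⟩, rfl⟩ := Submodule.mkQ_surjective _ y
        obtain ⟨a, rfl⟩ := (Submodule.Quotient.mk_eq_zero _).1 hy
        exact ⟨_, (hmk c a).symm⟩
      · rintro ⟨c, rfl⟩
        simp [i, p]
    obtain ⟨σ, hσ⟩ := hC.exists_lift hcoker hi hp hip LinearMap.id
    obtain ⟨k, hk⟩ := LinearMap.exists_comp_eq_of_forall_mem_range hi
      (h := N.mkQ ∘ₗ LinearMap.inr R C B - σ ∘ₗ (LinearMap.range f).mkQ) fun b => by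
        refine (hip _).1 ?_
        have := LinearMap.congr_fun hσ ((LinearMap.range f).mkQ b)
        rw [LinearMap.comp_apply, LinearMap.id_apply] at this
        rw [LinearMap.sub_apply, map_sub, LinearMap.comp_apply σ, this]
        exact sub_self _
    refine ⟨k, ?_⟩
    ext a
    apply hi
    change i (k (f a)) = i (h a)
    rw [hk, LinearMap.sub_apply, LinearMap.comp_apply σ,
      show (LinearMap.range f).mkQ (f a) = 0 from
        (Submodule.Quotient.mk_eq_zero _).2 ⟨a, rfl⟩, map_zero, sub_zero]
    simpa using hmk 0 a
  · have h0 := hC.linearMap_eq_zero hcoker ((LinearMap.range f).liftQ (k - l) (by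
      rintro _ ⟨a, rfl⟩
      have := LinearMap.congr_fun (hk.trans hl.symm) a
      simp only [LinearMap.comp_apply] at this
      simp [this]))
    ext b
    have := LinearMap.congr_fun h0 (Submodule.Quotient.mk b)
    simpa [sub_eq_zero] using this

end Orthogonality

/-! ### Separating maximal ideals in zero-dimensional quotients -/

section ZeroDimensional

variable {R : Type u} [CommRing R]

/-- A filter of ideals with a base of finitely generated ideals, with all the quotient rings by
ideals in `G` semilocal of Krull dimension zero. -/
structure IsSemilocalZeroDimFilter (G : Set (Ideal R)) : Prop where
  mono : ∀ {I J : Ideal R}, I ≤ J → I ∈ G → J ∈ G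
  exists_finset : ∀ I ∈ G, ∃ t : Finset R, (t : Set R) ⊆ I ∧ Ideal.span (t : Set R) ∈ G
  isMaximal : ∀ I ∈ G, ∀ p : Ideal R, p.IsPrime → I ≤ p → p.IsMaximal
  finite : ∀ I ∈ G, {m : Ideal R | m.IsMaximal ∧ I ≤ m}.Finite

theorem isSemilocalZeroDimFilter_gabrielFilter {U : Type u} [CommRing U] [Algebra R U]
    (hG : ∀ I ∈ gabrielFilter R U, IsSemilocalOfKrullDimZero (R ⧸ I)) :
    IsSemilocalZeroDimFilter (gabrielFilter R U) where
  mono := gabrielFilter_mono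
  exists_finset _ hI := exists_finset_span_mem_gabrielFilter hI
  isMaximal I hI p hp hIp := by
    have hs : Function.Surjective (Ideal.Quotient.mk I) := Ideal.Quotient.mk_surjective
    have hk : RingHom.ker (Ideal.Quotient.mk I) ≤ p := by rwa [Ideal.mk_ker]
    have h1 := (hG I hI).2 _ (Ideal.map_isPrime_of_surjective hs hk)
    have h2 := Ideal.comap_isMaximal_of_surjective (Ideal.Quotient.mk I) hs
      (K := p.map (Ideal.Quotient.mk I))
    rwa [Ideal.comap_map_of_surjective' _ hs, sup_eq_left.2 hk] at h2
  finite I hI := by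
    have hs : Function.Surjective (Ideal.Quotient.mk I) := Ideal.Quotient.mk_surjective
    refine ((hG I hI).1.image (Ideal.comap (Ideal.Quotient.mk I))).subset ?_
    rintro m ⟨hm, hIm⟩
    have hk : RingHom.ker (Ideal.Quotient.mk I) ≤ m := by rwa [Ideal.mk_ker]
    refine ⟨m.map (Ideal.Quotient.mk I), ?_, ?_⟩
    · exact (hG I hI).2 _ (Ideal.map_isPrime_of_surjective hs hk)
    · rw [Ideal.comap_map_of_surjective' _ hs, sup_eq_left.2 hk]

variable {G : Set (Ideal R)}

/-- Otherwise some prime over `I` avoids the product of the two complements. It is contained in both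
`m` and `n`, and being maximal it equals both. -/
theorem IsSemilocalZeroDimFilter.exists_mul_mem (hG : IsSemilocalZeroDimFilter G) {I : Ideal R}
    (hI : I ∈ G) {m n : Ideal R} [hm : m.IsMaximal] [hn : n.IsMaximal] (hmn : n ≠ m) :
    ∃ t ∉ m, ∃ x ∉ n, t * x ∈ I := by
  by_contra! hcon
  obtain ⟨p, hp, hIp, hd⟩ := Ideal.exists_le_prime_disjoint I (m.primeCompl ⊔ n.primeCompl) (by
    rw [Set.disjoint_left]
    intro a haI ha
    obtain ⟨t, ht, x, hx, rfl⟩ := Submonoid.mem_sup.1 ha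
    exact hcon t ht x hx haI)
  have hpmax := hG.isMaximal I hI p hp hIp
  rw [Set.disjoint_left] at hd
  have h1 : p = m := hpmax.eq_of_le hm.ne_top fun a ha => by
    by_contra hc
    exact hd ha (Submonoid.mem_sup_left hc)
  have h2 : p = n := hpmax.eq_of_le hn.ne_top fun a ha => by
    by_contra hc
    exact hd ha (Submonoid.mem_sup_right hc)
  exact hmn (h2.symm.trans h1)

theorem IsSemilocalZeroDimFilter.exists_pow_mul_mem (hG : IsSemilocalZeroDimFilter G)
    {I : Ideal R} (hI : I ∈ G) {m : Ideal R} [hm : m.IsMaximal] {s : R} (hs : s ∈ m) :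
    ∃ N : ℕ, ∃ t ∉ m, s ^ N * t ∈ I := by
  by_contra! hcon
  obtain ⟨p, hp, hIp, hd⟩ := Ideal.exists_le_prime_disjoint I (Submonoid.powers s ⊔ m.primeCompl)
    (by
      rw [Set.disjoint_left]
      intro a haI ha
      obtain ⟨_, ⟨N, rfl⟩, x, hx, rfl⟩ := Submonoid.mem_sup.1 ha
      exact hcon N x hx haI)
  have hpmax := hG.isMaximal I hI p hp hIp
  rw [Set.disjoint_left] at hd
  have h1 : p = m := hpmax.eq_of_le hm.ne_top fun a ha => by
    by_contra hc
    exact hd ha (Submonoid.mem_sup_right hc)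
  exact hd (h1 ▸ hs) (Submonoid.mem_sup_left (Submonoid.mem_powers s))

/-- The maximal ideals belonging to `G`. -/
abbrev MaximalIn (G : Set (Ideal R)) : Type u := {m : MaximalSpectrum R // m.asIdeal ∈ G}

/-- The localization at a maximal ideal belonging to `G`. -/
abbrev MaximalIn.Local (m : MaximalIn G) : Type u := Localization.AtPrime m.1.asIdeal

theorem IsSemilocalZeroDimFilter.finite_maximalIn (hG : IsSemilocalZeroDimFilter G) {I : Ideal R}
    (hI : I ∈ G) : {m : MaximalIn G | I ≤ m.1.asIdeal}.Finite := by
  refine Set.Finite.of_finite_image (f := fun m => m.1.asIdeal) ((hG.finite I hI).subset ?_) ?_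
  · rintro _ ⟨m, hm, rfl⟩
    exact ⟨m.1.isMaximal, hm⟩
  · intro m _ n _ h
    exact Subtype.ext (MaximalSpectrum.ext h)

/-- Only finitely many `n` contain `I`, so a finite product serves those; for any other `n` an
element of `I` outside `n` can be taken as `x`. -/
theorem IsSemilocalZeroDimFilter.exists_forall_mul_mem (hG : IsSemilocalZeroDimFilter G)
    {I : Ideal R} (hI : I ∈ G) (m : MaximalIn G) :
    ∃ t ∉ m.1.asIdeal, ∀ n : MaximalIn G, n ≠ m → ∃ x ∉ n.1.asIdeal, t * x ∈ I := by
  classical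
  have key : ∀ n : MaximalIn G, ∃ t ∉ m.1.asIdeal, n ≠ m → ∃ x ∉ n.1.asIdeal, t * x ∈ I := by
    intro n
    by_cases h : n = m
    · exact ⟨1, fun h1 => m.1.isMaximal.ne_top ((Ideal.eq_top_iff_one _).2 h1), fun h' =>
        absurd h h'⟩
    · have := m.1.isMaximal
      have := n.1.isMaximal
      obtain ⟨t, ht, h⟩ := hG.exists_mul_mem hI (m := m.1.asIdeal) (n := n.1.asIdeal)
        (fun h' => h (Subtype.ext (MaximalSpectrum.ext h')))
      exact ⟨t, ht, fun _ => h⟩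
  choose t ht hx using key
  have hfin := hG.finite_maximalIn hI
  have hmp := m.1.isMaximal.isPrime
  refine ⟨∏ n ∈ hfin.toFinset, t n, fun hmem => ?_, fun n hn => ?_⟩
  · obtain ⟨n, _, hn⟩ := (Ideal.IsPrime.prod_mem_iff).1 hmem
    exact ht n hn
  · by_cases hIn : I ≤ n.1.asIdeal
    · obtain ⟨x, hxn, hxI⟩ := hx n hn
      refine ⟨x, hxn, ?_⟩
      rw [← Finset.mul_prod_erase _ _ (hfin.mem_toFinset.2 hIn), mul_right_comm]
      exact Ideal.mul_mem_right _ _ hxI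
    · obtain ⟨x, hxI, hxn⟩ := Set.not_subset.1 hIn
      exact ⟨x, hxn, Ideal.mul_mem_left _ _ hxI⟩

theorem MaximalIn.isUnit_algebraMap (m : MaximalIn G) {x : R} (hx : x ∉ m.1.asIdeal) :
    IsUnit (algebraMap R m.Local x) :=
  IsLocalization.map_units m.Local (⟨x, hx⟩ : m.1.asIdeal.primeCompl)

theorem MaximalIn.smul_injective (m : MaximalIn G) {x : R} (hx : x ∉ m.1.asIdeal) {v : m.Local}
    (hv : x • v = 0) : v = 0 := by
  rw [Algebra.smul_def] at hv
  exact (m.isUnit_algebraMap hx).mul_right_eq_zero.1 hv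

theorem MaximalIn.exists_smul_eq (m : MaximalIn G) {x : R} (hx : x ∉ m.1.asIdeal) (v : m.Local) :
    ∃ v' : m.Local, x • v' = v := by
  obtain ⟨y, hy⟩ := (m.isUnit_algebraMap hx).exists_right_inv
  exact ⟨y * v, by rw [Algebra.smul_def, ← mul_assoc, hy, one_mul]⟩

end ZeroDimensional

/-! ### Comparing the ring with sums and products of its localizations -/

section TorsionFreeDivisible

variable {R : Type u} [CommRing R] {G : Set (Ideal R)}

theorem IsTorsionFreeDivisible.of_subsingleton (X : Type u) [AddCommGroup X] [Module R X]
    [Subsingleton X] : IsTorsionFreeDivisible G X :=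
  ⟨fun _ _ _ _ => Subsingleton.elim _ _, fun _ _ => Subsingleton.elim _ _⟩

theorem IsTorsionFreeDivisible.quotient {X : Type u} [AddCommGroup X] [Module R X]
    {N : Submodule R X} (h1 : ∀ I ∈ G, ∀ x, (∀ i ∈ I, i • x ∈ N) → x ∈ N)
    (h2 : ∀ I ∈ G, I • (⊤ : Submodule R X) ⊔ N = ⊤) : IsTorsionFreeDivisible G (X ⧸ N) where
  eq_zero I hI y hy := by
    obtain ⟨x, rfl⟩ := Submodule.mkQ_surjective _ y
    exact (Submodule.Quotient.mk_eq_zero N).2 (h1 I hI x fun i hi =>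
      (Submodule.Quotient.mk_eq_zero N).1 (hy i hi))
  smul_top I hI := by
    have := congrArg (Submodule.map N.mkQ) (h2 I hI)
    rwa [Submodule.map_sup, Submodule.map_smul'', Submodule.map_top, Submodule.range_mkQ,
      Submodule.mkQ_map_self, sup_bot_eq] at this

theorem mem_span_finset_smul_top_iff {M : Type*} [AddCommGroup M] [Module R M] {s : Finset R}
    {x : M} : x ∈ Ideal.span (s : Set R) • (⊤ : Submodule R M) ↔
      ∃ c : R → M, ∑ i ∈ s, i • c i = x := by
  constructor
  · intro hx
    refine Submodule.smul_induction_on hx (fun r hr y _ => ?_) ?_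
    · obtain ⟨a, -, rfl⟩ := Submodule.mem_span_finset.1 hr
      refine ⟨fun i => a i • y, ?_⟩
      rw [Finset.sum_smul]
      refine Finset.sum_congr rfl fun i _ => ?_
      rw [smul_smul, smul_eq_mul, mul_comm]
    · rintro _ _ ⟨c, rfl⟩ ⟨d, rfl⟩
      exact ⟨c + d, by simp [Finset.sum_add_distrib]⟩
  · rintro ⟨c, rfl⟩
    exact Submodule.sum_mem _ fun i hi =>
      Submodule.smul_mem_smul (Ideal.subset_span hi) trivial

/-- Finite generation matters here: all coordinates are expressed through the same finite set of
generators, so the coefficients assemble into elements of the product. -/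
theorem mem_span_finset_smul_top_pi {ι : Type*} {M : ι → Type*} [∀ i, AddCommGroup (M i)]
    [∀ i, Module R (M i)] {s : Finset R} {x : ∀ i, M i}
    (h : ∀ j, x j ∈ Ideal.span (s : Set R) • (⊤ : Submodule R (M j))) :
    x ∈ Ideal.span (s : Set R) • (⊤ : Submodule R (∀ i, M i)) := by
  simp only [mem_span_finset_smul_top_iff] at h
  choose c hc using h
  refine mem_span_finset_smul_top_iff.2 ⟨fun i j => c j i, ?_⟩
  ext j
  simp [hc]

variable (G) in
/-- The map from the ring to the product of its localizations at the maximal ideals in `G`. -/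
noncomputable def toPiLocal : R →ₗ[R] (∀ m : MaximalIn G, m.Local) :=
  LinearMap.pi fun m => Algebra.linearMap R m.Local

variable (G) in
/-- The embedding of the direct sum of the localizations at the maximal ideals in `G` into their
product. -/
noncomputable def directSumToPiLocal :
    (Π₀ m : MaximalIn G, m.Local) →ₗ[R] (∀ m : MaximalIn G, m.Local) :=
  DFinsupp.coeFnLinearMap R

theorem MaximalIn.exists_smul_eq_zero (m : MaximalIn G) {r : R}
    (hr : algebraMap R m.Local r = 0) : ∃ t ∉ m.1.asIdeal, t * r = 0 := by
  obtain ⟨t, ht⟩ := (IsLocalization.map_eq_zero_iff m.1.asIdeal.primeCompl m.Local r).1 hr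
  exact ⟨t, t.2, ht⟩

/-- A maximal ideal containing both `I` and the annihilator of `r` would be in `G`, yet `r` dies in
its localization. So the two ideals are comaximal. -/
theorem IsSemilocalZeroDimFilter.exists_mul_eq_self_of_toPiLocal_eq_zero
    (hG : IsSemilocalZeroDimFilter G) {r : R} (hr : toPiLocal G r = 0) {I : Ideal R}
    (hI : I ∈ G) : ∃ i ∈ I, i * r = r := by
  have htop : LinearMap.ker (LinearMap.toSpanSingleton R R r) ⊔ I = ⊤ := by
    by_contra hne
    obtain ⟨m, hm, hle⟩ := Ideal.exists_le_maximal _ hne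
    have hmG : m ∈ G := hG.mono (le_sup_right.trans hle) hI
    obtain ⟨t, ht, htr⟩ := MaximalIn.exists_smul_eq_zero (⟨⟨m, hm⟩, hmG⟩ : MaximalIn G)
      (congrFun hr _)
    exact ht (hle (Submodule.mem_sup_left htr))
  obtain ⟨a, ha, i, hi, hai⟩ := Submodule.mem_sup.1 ((Ideal.eq_top_iff_one _).1 htop)
  refine ⟨i, hi, ?_⟩
  have ha' : a * r = 0 := ha
  calc i * r = (a + i) * r := by rw [add_mul, ha', zero_add]
    _ = r := by rw [hai, one_mul]

theorem IsSemilocalZeroDimFilter.ker_toPiLocal (hG : IsSemilocalZeroDimFilter G) :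
    IsTorsionFreeDivisible G (LinearMap.ker (toPiLocal G)) where
  eq_zero I hI x hx := by
    obtain ⟨i, hi, hix⟩ := hG.exists_mul_eq_self_of_toPiLocal_eq_zero x.2 hI
    exact Subtype.ext (hix.symm.trans (congrArg Subtype.val (hx i hi)))
  smul_top I hI := by
    rw [eq_top_iff]
    intro x _
    obtain ⟨i, hi, hix⟩ := hG.exists_mul_eq_self_of_toPiLocal_eq_zero x.2 hI
    have : x = i • x := Subtype.ext hix.symm
    rw [this]
    exact Submodule.smul_mem_smul hi trivial

theorem MaximalIn.exists_smul_sub_apply_eq_zero (m : MaximalIn G) (w : ∀ m : MaximalIn G, m.Local) :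
    ∃ s ∉ m.1.asIdeal, ∃ r : R, (s • w - toPiLocal G r) m = 0 := by
  obtain ⟨r, s, h⟩ := IsLocalization.exists_mk'_eq m.1.asIdeal.primeCompl (w m)
  refine ⟨s, s.2, r, ?_⟩
  rw [Pi.sub_apply, Pi.smul_apply, ← h, Algebra.smul_def, IsLocalization.mk'_spec']
  exact sub_self _

/-- Both halves are local: if the ideal of multipliers carrying `w` into the relevant submodule were
proper, it would lie in a maximal ideal `m`, necessarily in `G`; a multiplier outside `m` is then
constructed. -/
theorem IsSemilocalZeroDimFilter.coker_toPiLocal (hG : IsSemilocalZeroDimFilter G) :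
    IsTorsionFreeDivisible G ((∀ m : MaximalIn G, m.Local) ⧸ LinearMap.range (toPiLocal G)) := by
  classical
  refine .quotient (fun I hI w hw => ?_) fun I hI => ?_
  · obtain ⟨S, hSI, hS⟩ := hG.exists_finset I hI
    let 𝔞 : Ideal R := (LinearMap.range (toPiLocal G)).comap (LinearMap.toSpanSingleton R _ w)
    have h𝔞 : ∀ a, a ∈ 𝔞 ↔ a • w ∈ LinearMap.range (toPiLocal G) := fun a => Iff.rfl
    by_contra hne
    have h1 : 𝔞 ≠ ⊤ := fun h => hne (by
      have := (h𝔞 1).1 (h ▸ trivial)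
      rwa [one_smul] at this)
    obtain ⟨m, hm, hle⟩ := Ideal.exists_le_maximal _ h1
    have hI𝔞 : I ≤ 𝔞 := fun i hi => hw i hi
    let μ : MaximalIn G := ⟨⟨m, hm⟩, hG.mono (hI𝔞.trans hle) hI⟩
    obtain ⟨s, hs, r, hr⟩ := μ.exists_smul_sub_apply_eq_zero w
    have h2 : ∀ i ∈ S, ∃ q : R, ∃ t ∉ m, i • (s • w - toPiLocal G r) = toPiLocal G q ∧
        t * q = 0 := fun i hi => by
      obtain ⟨q, hq⟩ := hw i (hSI hi)
      have e1 : i • (s • w - toPiLocal G r) = toPiLocal G (s * q - i * r) := by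
        rw [map_sub, ← smul_eq_mul s, ← smul_eq_mul i, map_smul, map_smul, hq, smul_sub,
          smul_comm]
      obtain ⟨t, ht, htq⟩ := μ.exists_smul_eq_zero (r := s * q - i * r) (by
        have := congrFun e1 μ
        rw [Pi.smul_apply, hr, smul_zero] at this
        exact this.symm)
      exact ⟨_, t, ht, e1, htq⟩
    choose! q t ht hq htq using h2
    have hmp := hm.isPrime
    let T := ∏ i ∈ S, t i
    have hT : T ∉ m := fun hmem => by
      obtain ⟨i, hi, h⟩ := Ideal.IsPrime.prod_mem_iff.1 hmem
      exact ht i hi h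
    have hTq : ∀ i ∈ S, T * q i = 0 := fun i hi => by
      change (∏ i ∈ S, t i) * q i = 0
      rw [← Finset.prod_erase_mul S t hi, mul_assoc, htq i hi, mul_zero]
    have hkill : ∀ i ∈ Ideal.span (S : Set R), i • T • (s • w - toPiLocal G r) = 0 := by
      intro i hi
      refine Submodule.span_induction (p := fun i _ => i • T • (s • w - toPiLocal G r) = 0)
        (fun i hi => ?_) (zero_smul _ _) (fun x y _ _ hx hy => by rw [add_smul, hx, hy, add_zero])
        (fun a x _ hx => by rw [smul_assoc, hx, smul_zero]) hi
      rw [smul_comm, hq i hi, ← map_smul, smul_eq_mul, hTq i hi, map_zero]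
    -- At `μ` the vector already vanishes. At `n ≠ μ` some `x ∉ n` has `z * x` in the span of `S`,
    -- which kills the vector, and `x` acts injectively.
    obtain ⟨z, hz, hzx⟩ := hG.exists_forall_mul_mem hS μ
    have hzero : z • T • (s • w - toPiLocal G r) = 0 := by
      ext n
      by_cases hn : n = μ
      · subst hn
        rw [Pi.smul_apply, Pi.smul_apply, hr, smul_zero, smul_zero, Pi.zero_apply]
      · obtain ⟨x, hx, hzx⟩ := hzx n hn
        refine n.smul_injective hx ?_
        have := congrFun (hkill _ hzx) n
        rw [mul_comm, mul_smul] at this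
        exact this
    refine absurd (hle ((h𝔞 (z * T * s)).2 ⟨z * T * r, ?_⟩)) fun hmem => ?_
    · rw [← smul_eq_mul (z * T) r, map_smul, mul_smul (z * T) s, eq_comm, ← sub_eq_zero,
        ← smul_sub, mul_smul, hzero]
    · rcases hmp.mem_or_mem hmem with h | h
      · rcases hmp.mem_or_mem h with h | h
        · exact hz h
        · exact hT h
      · exact hs h
  · obtain ⟨S, hSI, hS⟩ := hG.exists_finset I hI
    rw [eq_top_iff]
    intro w _
    set N := I • (⊤ : Submodule R (∀ m : MaximalIn G, m.Local)) ⊔ LinearMap.range (toPiLocal G)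
    let 𝔞 : Ideal R := N.comap (LinearMap.toSpanSingleton R _ w)
    have h𝔞 : ∀ a, a ∈ 𝔞 ↔ a • w ∈ N := fun a => Iff.rfl
    by_contra hne
    have h1 : 𝔞 ≠ ⊤ := fun h => hne (by
      have := (h𝔞 1).1 (h ▸ trivial)
      rwa [one_smul] at this)
    obtain ⟨m, hm, hle⟩ := Ideal.exists_le_maximal _ h1
    have hI𝔞 : I ≤ 𝔞 := fun i hi =>
      Submodule.mem_sup_left (Submodule.smul_mem_smul hi trivial)
    let μ : MaximalIn G := ⟨⟨m, hm⟩, hG.mono (hI𝔞.trans hle) hI⟩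
    obtain ⟨s, hs, r, hr⟩ := μ.exists_smul_sub_apply_eq_zero w
    obtain ⟨z, hz, hzx⟩ := hG.exists_forall_mul_mem hS μ
    have hmem : z • (s • w - toPiLocal G r) ∈ I • (⊤ : Submodule R (∀ m : MaximalIn G, m.Local)) := by
      refine Submodule.smul_mono_left (Ideal.span_le.2 hSI) (mem_span_finset_smul_top_pi fun n => ?_)
      by_cases hn : n = μ
      · subst hn
        rw [Pi.smul_apply, hr, smul_zero]
        exact zero_mem _
      · obtain ⟨x, hx, hzx⟩ := hzx n hn
        obtain ⟨v, hv⟩ := n.exists_smul_eq hx ((s • w - toPiLocal G r) n)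
        rw [Pi.smul_apply, ← hv, smul_smul]
        exact Submodule.smul_mem_smul hzx trivial
    refine absurd (hle ((h𝔞 (z * s)).2 ?_)) fun hmem => ?_
    · have : (z * s) • w = z • (s • w - toPiLocal G r) + toPiLocal G (z * r) := by
        rw [← smul_eq_mul z r, map_smul, ← smul_add, sub_add_cancel, mul_smul]
      rw [this]
      exact add_mem (Submodule.mem_sup_left hmem) (Submodule.mem_sup_right ⟨_, rfl⟩)
    · rcases hm.isPrime.mem_or_mem hmem with h | h
      · exact hz h
      · exact hs h

theorem mem_range_directSumToPiLocal {w : ∀ m : MaximalIn G, m.Local}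
    (hw : {m | w m ≠ 0}.Finite) : w ∈ LinearMap.range (directSumToPiLocal G) := by
  classical
  refine ⟨DFinsupp.mk hw.toFinset fun m => w m, ?_⟩
  ext m
  change DFinsupp.mk hw.toFinset (fun m => w m) m = w m
  rw [DFinsupp.mk_apply]
  split_ifs with h
  · rfl
  · exact (not_not.1 fun hc => h (hw.mem_toFinset.2 hc)).symm

theorem finite_support_of_mem_range_directSumToPiLocal {w : ∀ m : MaximalIn G, m.Local}
    (hw : w ∈ LinearMap.range (directSumToPiLocal G)) : {m | w m ≠ 0}.Finite := by
  obtain ⟨v, rfl⟩ := hw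
  exact DFinsupp.finite_support v

theorem ker_directSumToPiLocal :
    IsTorsionFreeDivisible G (LinearMap.ker (directSumToPiLocal G)) := by
  have : LinearMap.ker (directSumToPiLocal G) = ⊥ :=
    LinearMap.ker_eq_bot.2 DFunLike.coe_injective
  rw [this]
  exact .of_subsingleton _

/-- Away from the finitely many `m` containing `S`, some generator acts invertibly on the
localization. Thus supports can only shrink at those finitely many places, and the other components
are divisible. -/
theorem IsSemilocalZeroDimFilter.coker_directSumToPiLocal (hG : IsSemilocalZeroDimFilter G) :
    IsTorsionFreeDivisible G
      ((∀ m : MaximalIn G, m.Local) ⧸ LinearMap.range (directSumToPiLocal G)) := by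
  classical
  refine .quotient (fun I hI w hw => ?_) fun I hI => ?_
  · obtain ⟨S, hSI, hS⟩ := hG.exists_finset I hI
    refine mem_range_directSumToPiLocal (((hG.finite_maximalIn hS).union
      (S.finite_toSet.biUnion fun i hi =>
        finite_support_of_mem_range_directSumToPiLocal (hw i (hSI hi)))).subset fun m hm => ?_)
    by_cases hSm : (S : Set R) ⊆ m.1.asIdeal
    · exact Or.inl (Ideal.span_le.2 hSm)
    · obtain ⟨i, hi, him⟩ := Set.not_subset.1 hSm
      exact Or.inr (Set.mem_biUnion hi fun h => hm (m.smul_injective him h))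
  · obtain ⟨S, hSI, hS⟩ := hG.exists_finset I hI
    rw [eq_top_iff]
    intro w _
    have hfin := hG.finite_maximalIn hS
    let v : ∀ m : MaximalIn G, m.Local := fun m => if (S : Set R) ⊆ m.1.asIdeal then w m else 0
    have hv : v ∈ LinearMap.range (directSumToPiLocal G) :=
      mem_range_directSumToPiLocal (hfin.subset fun m hm => by
        by_contra hc
        exact hm (if_neg fun h => hc (Ideal.span_le.2 h)))
    have hwv : w - v ∈ I • (⊤ : Submodule R (∀ m : MaximalIn G, m.Local)) := by
      refine Submodule.smul_mono_left (Ideal.span_le.2 hSI) (mem_span_finset_smul_top_pi fun n => ?_)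
      by_cases hSn : (S : Set R) ⊆ n.1.asIdeal
      · rw [Pi.sub_apply, show v n = w n from if_pos hSn, sub_self]
        exact zero_mem _
      · obtain ⟨i, hi, hin⟩ := Set.not_subset.1 hSn
        obtain ⟨y, hy⟩ := n.exists_smul_eq hin ((w - v) n)
        rw [← hy]
        exact Submodule.smul_mem_smul (Ideal.subset_span hi) trivial
    rw [← sub_add_cancel w v]
    exact add_mem (Submodule.mem_sup_left hwv) (Submodule.mem_sup_right hv)

end TorsionFreeDivisible

/-! ### Decomposing a contramodule over the maximal ideals in the filter -/

section Decomposition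

variable {R U : Type u} [CommRing R] [CommRing U] [Algebra R U] [Module.Flat R U]
  [Algebra.IsEpi R U] {C : Type u} [AddCommGroup C] [Module R C]

theorem IsUContramodule.bijective_lcomp (hC : IsUContramodule R U C) {A B : Type u}
    [AddCommGroup A] [Module R A] [AddCommGroup B] [Module R B] (f : A →ₗ[R] B)
    (hker : IsTorsionFreeDivisible (gabrielFilter R U) (LinearMap.ker f))
    (hcoker : IsTorsionFreeDivisible (gabrielFilter R U) (B ⧸ LinearMap.range f)) :
    Function.Bijective (LinearMap.lcomp R C f) :=
  (Function.bijective_iff_existsUnique _).2 (hC.existsUnique_extension f hker hcoker)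

theorem IsUContramodule.nonempty_equiv_pi (hC : IsUContramodule R U C)
    (hG : IsSemilocalZeroDimFilter (gabrielFilter R U)) :
    Nonempty ((∀ m : MaximalIn (gabrielFilter R U), m.Local →ₗ[R] C) ≃ₗ[R] C) := by
  classical
  exact ⟨DFinsupp.lsum R ≪≫ₗ
    (LinearEquiv.ofBijective _ (hC.bijective_lcomp _ ker_directSumToPiLocal
      hG.coker_directSumToPiLocal)).symm ≪≫ₗ
    LinearEquiv.ofBijective _ (hC.bijective_lcomp _ hG.ker_toPiLocal hG.coker_toPiLocal) ≪≫ₗ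
    LinearMap.ringLmapEquivSelf R R C⟩

end Decomposition

/-! ### Contramodules with respect to one element -/

section ElementContramodule

variable {R : Type u} [CommRing R]

/-- The endomorphism `(b k) ↦ (b k - s • b (k + 1))` of the module of sequences in `C`. -/
def subSMulShift (s : R) (C : Type*) [AddCommGroup C] [Module R C] : (ℕ → C) →ₗ[R] (ℕ → C) :=
  LinearMap.pi fun k => LinearMap.proj k - s • LinearMap.proj (k + 1)

@[simp]
theorem subSMulShift_apply (s : R) {C : Type*} [AddCommGroup C] [Module R C] (b : ℕ → C) (k : ℕ) :
    subSMulShift s C b k = b k - s • b (k + 1) := rfl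

/-- A module `C` is an `s`-contramodule if the equations `b k - s • b (k + 1) = a k` have a unique
solution `b` for every sequence `a` in `C`. -/
def IsElementContramodule (s : R) (C : Type*) [AddCommGroup C] [Module R C] : Prop :=
  Function.Bijective (subSMulShift s C)

theorem IsElementContramodule.ker {s : R} {A B : Type*} [AddCommGroup A] [Module R A]
    [AddCommGroup B] [Module R B] (hA : IsElementContramodule s A)
    (hB : IsElementContramodule s B) (f : A →ₗ[R] B) :
    IsElementContramodule s (LinearMap.ker f) := by
  refine ⟨fun b c h => ?_, fun a => ?_⟩
  · have : (fun k => (b k : A)) = fun k => (c k : A) := hA.1 (by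
      ext k
      exact congrArg Subtype.val (congrFun h k))
    ext k
    exact congrFun this k
  · obtain ⟨b, hb⟩ := hA.2 fun k => (a k : A)
    have h0 : (fun k => f (b k)) = 0 := hB.1 (by
      ext k
      have := congrArg f (congrFun hb k)
      rw [subSMulShift_apply, map_sub, map_smul, LinearMap.map_coe_ker] at this
      rw [subSMulShift_apply, this, map_zero, Pi.zero_apply])
    refine ⟨fun k => ⟨b k, congrFun h0 k⟩, ?_⟩
    ext k
    exact congrFun hb k

theorem IsElementContramodule.coker {s : R} {A B : Type*} [AddCommGroup A] [Module R A]
    [AddCommGroup B] [Module R B] (hA : IsElementContramodule s A)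
    (hB : IsElementContramodule s B) (f : A →ₗ[R] B) :
    IsElementContramodule s (B ⧸ LinearMap.range f) := by
  have hq := Submodule.mkQ_surjective (LinearMap.range f)
  refine ⟨(injective_iff_map_eq_zero _).2 fun b hb => ?_, fun a => ?_⟩
  · choose b' hb' using fun k => hq (b k)
    have h1 : ∀ k, ∃ a, f a = subSMulShift s B b' k := fun k => by
      refine (Submodule.Quotient.mk_eq_zero (LinearMap.range f)).1 ?_
      have := congrFun hb k
      rw [subSMulShift_apply, ← hb', ← hb', ← map_smul, ← map_sub] at this
      exact this
    choose a ha using h1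
    obtain ⟨a', rfl⟩ := hA.2 a
    have h2 : b' = fun k => f (a' k) := hB.1 (by
      ext k
      rw [← ha]
      simp)
    ext k
    rw [← hb', h2]
    exact (Submodule.Quotient.mk_eq_zero _).2 ⟨_, rfl⟩
  · choose a' ha' using fun k => hq (a k)
    obtain ⟨b, rfl⟩ := hB.2 a'
    refine ⟨fun k => (LinearMap.range f).mkQ (b k), ?_⟩
    ext k
    rw [← ha']
    simp

end ElementContramodule

/-! ### The local factors are contramodules for each element of the maximal ideal -/

section LocalFactors

variable {R : Type u} [CommRing R] {G : Set (Ideal R)}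

/-- The identity minus the multiplication by `s` composed with the shift, on the direct sum of
copies of the localization at `m`. -/
noncomputable def MaximalIn.idSubSMulShift (m : MaximalIn G) (s : R) :
    (ℕ →₀ m.Local) →ₗ[R] (ℕ →₀ m.Local) :=
  LinearMap.id - s • Finsupp.lmapDomain m.Local R Nat.succ

theorem MaximalIn.idSubSMulShift_single (m : MaximalIn G) (s : R) (k : ℕ) (l : m.Local) :
    m.idSubSMulShift s (Finsupp.single k l) =
      Finsupp.single k l - s • Finsupp.single (k + 1) l := by
  simp [MaximalIn.idSubSMulShift, Finsupp.mapDomain_single]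

theorem MaximalIn.ker_idSubSMulShift (m : MaximalIn G) (s : R) :
    IsTorsionFreeDivisible G (LinearMap.ker (m.idSubSMulShift s)) := by
  have : LinearMap.ker (m.idSubSMulShift s) = ⊥ := by
    rw [LinearMap.ker_eq_bot']
    intro c hc
    have hc' : c = s • Finsupp.mapDomain Nat.succ c := sub_eq_zero.1 hc
    ext k
    induction k with
    | zero =>
      rw [hc', Finsupp.smul_apply, Finsupp.mapDomain_of_notMem_range _ _ (by simp), smul_zero]
      rfl
    | succ k ih =>
      rw [hc', Finsupp.smul_apply, ← Nat.succ_eq_add_one,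
        Finsupp.mapDomain_apply Nat.succ_injective, ih]
      exact smul_zero s
  rw [this]
  exact .of_subsingleton _

/-- A telescoping sum: modulo the range, `c` agrees with `s` times its shift. -/
theorem MaximalIn.sub_pow_smul_shift_mem_range (m : MaximalIn G) (s : R) (N : ℕ)
    (c : ℕ →₀ m.Local) :
    c - s ^ N • ((Finsupp.lmapDomain m.Local R Nat.succ) ^ N) c ∈
      LinearMap.range (m.idSubSMulShift s) := by
  induction N with
  | zero => simp
  | succ N ih =>
    have := add_mem ih (Submodule.smul_mem _ (s ^ N)
      (⟨((Finsupp.lmapDomain m.Local R Nat.succ) ^ N) c, rfl⟩ :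
        _ ∈ LinearMap.range (m.idSubSMulShift s)))
    convert this using 1
    rw [MaximalIn.idSubSMulShift, LinearMap.sub_apply, LinearMap.id_apply, LinearMap.smul_apply,
      smul_sub, smul_smul, ← pow_succ, sub_add_sub_cancel, pow_succ' (Finsupp.lmapDomain _ _ _)]
    rfl

theorem MaximalIn.shift_pow_mem_range (m : MaximalIn G) (s : R) (N : ℕ)
    {c : ℕ →₀ m.Local} (hc : c ∈ LinearMap.range (m.idSubSMulShift s)) :
    ((Finsupp.lmapDomain m.Local R Nat.succ) ^ N) c ∈ LinearMap.range (m.idSubSMulShift s) := by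
  obtain ⟨d, rfl⟩ := hc
  refine ⟨((Finsupp.lmapDomain m.Local R Nat.succ) ^ N) d, ?_⟩
  rw [MaximalIn.idSubSMulShift, LinearMap.sub_apply, LinearMap.sub_apply, map_sub,
    LinearMap.smul_apply, LinearMap.smul_apply, map_smul]
  simp only [← Module.End.mul_apply]
  rw [← pow_succ', ← pow_succ]
  rfl

theorem MaximalIn.local_smul_mem_range (m : MaximalIn G) (s : R) (l : m.Local)
    {c : ℕ →₀ m.Local} (hc : c ∈ LinearMap.range (m.idSubSMulShift s)) :
    l • c ∈ LinearMap.range (m.idSubSMulShift s) := by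
  obtain ⟨d, rfl⟩ := hc
  refine ⟨l • d, ?_⟩
  simp only [MaximalIn.idSubSMulShift, LinearMap.sub_apply, LinearMap.id_apply,
    LinearMap.smul_apply, Finsupp.lmapDomain_apply, Finsupp.mapDomain_smul, smul_sub]
  rw [smul_comm]

theorem IsSemilocalZeroDimFilter.coker_idSubSMulShift (hG : IsSemilocalZeroDimFilter G)
    (m : MaximalIn G) {s : R} (hs : s ∈ m.1.asIdeal) :
    IsTorsionFreeDivisible G ((ℕ →₀ m.Local) ⧸ LinearMap.range (m.idSubSMulShift s)) := by
  have hm := m.1.isMaximal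
  refine .quotient (fun I hI c hc => ?_) fun I hI => ?_
  -- Since `t` is invertible in the localization and the range is stable under it, `s ^ N • c` lies
  -- in the range. So does its `N`-fold shift, which is congruent to `c`.
  · obtain ⟨N, t, ht, hst⟩ := hG.exists_pow_mul_mem hI hs
    obtain ⟨l, hl⟩ := (m.isUnit_algebraMap ht).exists_left_inv
    have h1 := m.local_smul_mem_range s l (hc _ hst)
    have h2 : l • (s ^ N * t) • c = s ^ N • c := by
      rw [mul_smul, smul_comm l, ← algebraMap_smul m.Local t c, smul_smul, hl, one_smul]
    rw [h2] at h1
    have h3 := m.shift_pow_mem_range s N h1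
    rw [map_smul] at h3
    have := add_mem (m.sub_pow_smul_shift_mem_range s N c) h3
    rwa [sub_add_cancel] at this
  · obtain ⟨N, t, ht, hst⟩ := hG.exists_pow_mul_mem hI hs
    obtain ⟨l, hl⟩ := (m.isUnit_algebraMap ht).exists_right_inv
    rw [eq_top_iff]
    intro c _
    set d := ((Finsupp.lmapDomain m.Local R Nat.succ) ^ N) c with hd
    have h1 : s ^ N • d = (s ^ N * t) • l • d := by
      rw [mul_smul, ← algebraMap_smul m.Local t (l • d), smul_smul, hl, one_smul]
    rw [← add_sub_cancel (s ^ N • d) c, h1]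
    refine add_mem (Submodule.mem_sup_left (Submodule.smul_mem_smul hst trivial)) ?_
    rw [← h1]
    exact Submodule.mem_sup_right (m.sub_pow_smul_shift_mem_range s N c)

variable {U : Type u} [CommRing U] [Algebra R U] [Module.Flat R U]
  [Algebra.IsEpi R U] {C : Type u} [AddCommGroup C] [Module R C]

theorem IsUContramodule.isElementContramodule (hC : IsUContramodule R U C)
    (hG : IsSemilocalZeroDimFilter (gabrielFilter R U)) (m : MaximalIn (gabrielFilter R U))
    {s : R} (hs : s ∈ m.1.asIdeal) : IsElementContramodule s (m.Local →ₗ[R] C) := by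
  have hbij := hC.bijective_lcomp _ (m.ker_idSubSMulShift s) (hG.coker_idSubSMulShift m hs)
  let e : (ℕ → (m.Local →ₗ[R] C)) ≃ₗ[R] ((ℕ →₀ m.Local) →ₗ[R] C) := Finsupp.lsum R
  have key : ∀ b : ℕ → (m.Local →ₗ[R] C),
      e (subSMulShift s _ b) = LinearMap.lcomp R C (m.idSubSMulShift s) (e b) := by
    intro b
    ext k : 1
    refine LinearMap.ext fun l => ?_
    have he : ∀ b j l, e b (Finsupp.single j l) = b j l := fun b j l =>
      Finsupp.sum_single_index (map_zero (b j))
    rw [LinearMap.comp_apply, LinearMap.comp_apply, LinearMap.lcomp_apply,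
      Finsupp.lsingle_apply, m.idSubSMulShift_single, map_sub, map_smul, he, he, he]
    rfl
  have : ⇑(subSMulShift s (m.Local →ₗ[R] C)) =
      e.symm ∘ LinearMap.lcomp R C (m.idSubSMulShift s) ∘ e := by
    ext1 b
    rw [Function.comp_apply, Function.comp_apply, ← key, e.symm_apply_apply]
  rw [IsElementContramodule, this]
  exact e.symm.bijective.comp (hbij.comp e.bijective)

end LocalFactors

/-! ### Isomorphisms and countable products -/

section Obtainable

variable {R : Type u} [CommRing R] {E : ∀ (M : Type u) [AddCommGroup M] [Module R M], Prop}

theorem SimplyRightObtainable.of_equiv {A B : Type u} [AddCommGroup A] [Module R A]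
    [AddCommGroup B] [Module R B] (e : A ≃ₗ[R] B) (hA : SimplyRightObtainable E A) :
    SimplyRightObtainable E B := by
  refine .extension e.toLinearMap (0 : B →ₗ[R] (PEmpty.{u + 1} → PUnit.{u + 1})) e.injective
    (fun b => ?_) (fun x => ⟨0, Subsingleton.elim _ _⟩) hA (.product _ fun i => i.elim)
  exact ⟨fun _ => e.surjective b, fun _ => rfl⟩

theorem SimplyRightObtainable.pi_nat {M : ℕ → Type u} [∀ i, AddCommGroup (M i)]
    [∀ i, Module R (M i)] (h : ∀ i, SimplyRightObtainable E (M i)) :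
    SimplyRightObtainable E (∀ i, M i) :=
  .of_equiv (LinearEquiv.piCongrLeft R M Equiv.ulift.{u})
    (.product (fun i : ULift.{u} ℕ => M i.down) fun i => h i.down)

end Obtainable

/-! ### The adic filtration of a contramodule -/

section Completion

variable {R : Type u} [CommRing R] {E : ∀ (M : Type u) [AddCommGroup M] [Module R M], Prop}
  {C : Type u} [AddCommGroup C] [Module R C] {s : R}

theorem IsElementContramodule.obtainable_iInf_range_pow (hC : IsElementContramodule s C)
    (h : ∀ n : ℕ, SimplyRightObtainable E (LinearMap.ker (LinearMap.lsmul R C (s ^ n)))) :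
    SimplyRightObtainable E
      (⨅ n : ℕ, LinearMap.range (LinearMap.lsmul R C (s ^ n)) : Submodule R C) := by
  let T := ∀ n : ℕ, LinearMap.ker (LinearMap.lsmul R C (s ^ n))
  let e : (ℕ → C) ≃ₗ[R] (ℕ → C) := LinearEquiv.ofBijective _ hC
  let ι : T →ₗ[R] (ℕ → C) := LinearMap.pi fun n => Submodule.subtype _ ∘ₗ LinearMap.proj n
  have hι : ∀ (t : T) n, ι t n = t n := fun _ _ => rfl
  have hιinj : Function.Injective ι := fun t t' htt' => by
    ext n
    exact congrFun htt' n
  have hT : ∀ (t : T) n, s ^ n • (t n : C) = 0 := fun t n => (t n).2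
  let φ : T →ₗ[R] T := LinearMap.pi fun n =>
    (LinearMap.proj n ∘ₗ subSMulShift s C ∘ₗ ι).codRestrict _ fun t => by
      have h1 := hT t n
      have h2 : s ^ n • s • (t (n + 1) : C) = 0 := by
        rw [smul_smul, ← pow_succ]
        exact hT t (n + 1)
      change s ^ n • ((t n : C) - s • (t (n + 1) : C)) = 0
      rw [smul_sub, h1, h2, sub_zero]
  have hsol : ∀ t : T, ∀ n, e.symm (ι t) 0 = s ^ n • e.symm (ι t) n := by
    intro t n
    induction n with
    | zero => rw [pow_zero, one_smul]
    | succ n ih =>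
      have h1 : e.symm (ι t) n - s • e.symm (ι t) (n + 1) = t n :=
        congrFun (e.apply_symm_apply (ι t)) n
      rw [ih, sub_eq_iff_eq_add.1 h1, smul_add, hT, zero_add, smul_smul, ← pow_succ]
  let ψ : T →ₗ[R] (⨅ n : ℕ, LinearMap.range (LinearMap.lsmul R C (s ^ n)) : Submodule R C) :=
    (LinearMap.proj 0 ∘ₗ e.symm.toLinearMap ∘ₗ ι).codRestrict _ fun t =>
      (Submodule.mem_iInf _).2 fun n => ⟨e.symm (ι t) n, (hsol t n).symm⟩
  -- `ψ` solves the equations with right-hand side `t` and takes the zeroth term `b 0 = s ^ n • b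
  -- n`. It vanishes exactly when each `b n` is killed by `s ^ n`, that is, when `t` comes from `φ`.
  refine .cokernel φ ψ (fun t t' htt' => hιinj (hC.1 (congrArg ι htt'))) (fun t => ⟨?_, ?_⟩) ?_
    (.pi_nat h) (.pi_nat h)
  · intro ht
    have h0 : e.symm (ι t) 0 = 0 := congrArg Subtype.val ht
    refine ⟨fun n => ⟨e.symm (ι t) n, ?_⟩, hιinj ?_⟩
    · change s ^ n • e.symm (ι t) n = 0
      rw [← hsol, h0]
    · exact e.apply_symm_apply (ι t)
  · rintro ⟨t, rfl⟩
    refine Subtype.ext ?_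
    change e.symm (ι (φ t)) 0 = 0
    have h1 : e.symm (ι (φ t)) = ι t := e.symm_apply_apply (ι t)
    rw [h1, hι]
    -- The zeroth factor is the kernel of `s ^ 0 = 1`, hence zero.
    simpa using hT t 0
  · rintro ⟨x, hx⟩
    choose y hy using fun n => (Submodule.mem_iInf _).1 hx n
    replace hy : ∀ n, s ^ n • y n = x := hy
    have hmem : ∀ n, s ^ n • (subSMulShift s C y n) = 0 := fun n => by
      rw [subSMulShift_apply, smul_sub, smul_smul, ← pow_succ, hy, hy, sub_self]
    refine ⟨fun n => ⟨subSMulShift s C y n, hmem n⟩, Subtype.ext ?_⟩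
    change e.symm (e y) 0 = x
    rw [e.symm_apply_apply, ← hy 0, pow_zero, one_smul]

/-- The decreasing filtration of `C` by the submodules `s ^ n • C`, continued to the ordinals
`i ≥ ω` by their intersection. -/
def powFiltration (s : R) (C : Type u) [AddCommGroup C] [Module R C] (i : Ordinal.{u}) :
    Submodule R C :=
  ⨅ (n : ℕ) (_ : (n : Ordinal.{u}) ≤ i), LinearMap.range (LinearMap.lsmul R C (s ^ n))

theorem mem_powFiltration {i : Ordinal.{u}} {x : C} :
    x ∈ powFiltration s C i ↔ ∀ n : ℕ, (n : Ordinal.{u}) ≤ i → ∃ y, s ^ n • y = x := by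
  simp [powFiltration, Submodule.mem_iInf]

theorem powFiltration_le (s : R) (C : Type u) [AddCommGroup C] [Module R C] {i j : Ordinal.{u}}
    (hij : i ≤ j) : powFiltration s C j ≤ powFiltration s C i :=
  fun _ hx => mem_powFiltration.2 fun n hn => mem_powFiltration.1 hx n (hn.trans hij)

theorem mem_powFiltration_natCast {n : ℕ} {x : C} :
    x ∈ powFiltration s C (n : Ordinal.{u}) ↔ ∃ y, s ^ n • y = x := by
  refine ⟨fun hx => mem_powFiltration.1 hx n le_rfl, ?_⟩
  rintro ⟨y, rfl⟩
  refine mem_powFiltration.2 fun k hk => ⟨s ^ (n - k) • y, ?_⟩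
  rw [smul_smul, ← pow_add, Nat.add_sub_cancel' (Nat.cast_le.1 hk)]

theorem powFiltration_natCast (s : R) (C : Type u) [AddCommGroup C] [Module R C] (n : ℕ) :
    powFiltration s C (n : Ordinal.{u}) = LinearMap.range (LinearMap.lsmul R C (s ^ n)) := by
  ext x
  exact mem_powFiltration_natCast

theorem powFiltration_omega0 (s : R) (C : Type u) [AddCommGroup C] [Module R C] :
    powFiltration s C Ordinal.omega0 =
      ⨅ n : ℕ, LinearMap.range (LinearMap.lsmul R C (s ^ n)) := by
  ext x
  rw [mem_powFiltration, Submodule.mem_iInf]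
  exact ⟨fun h n => h n (Ordinal.natCast_lt_omega0 n).le, fun h n _ => h n⟩

theorem IsElementContramodule.exists_forall_sub_mem_powFiltration
    (hC : IsElementContramodule s C) {c : ℕ → C}
    (hc : ∀ n : ℕ, c (n + 1) - c n ∈ powFiltration s C (n : Ordinal.{u})) :
    ∃ y, ∀ n : ℕ, y - c n ∈ powFiltration s C (n : Ordinal.{u}) := by
  choose a ha using fun n => mem_powFiltration_natCast.1 (hc n)
  obtain ⟨b, hb⟩ := hC.2 a
  -- With `c (n + 1) - c n = s ^ n • a n`, telescoping gives `c 0 + b 0 - c n = s ^ n • b n`.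
  refine ⟨c 0 + b 0, fun n => mem_powFiltration_natCast.2 ⟨b n, ?_⟩⟩
  induction n with
  | zero => simp
  | succ n ih =>
    have h2 : b n - s • b (n + 1) = a n := congrFun hb n
    have h3 := ha n
    rw [← h2, smul_sub, smul_smul, ← pow_succ, ih, sub_eq_iff_eq_add] at h3
    rw [eq_comm, sub_eq_iff_eq_add, eq_comm, ← sub_eq_zero]
    rw [← sub_eq_zero] at h3
    rw [← neg_eq_zero, ← h3]
    abel

theorem eq_of_forall_factor_powFiltration_eq
    {y z : C ⧸ powFiltration s C Ordinal.omega0.{u}}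
    (h : ∀ (n : ℕ), Submodule.factor (powFiltration_le s C (Ordinal.natCast_lt_omega0 n).le) y =
      Submodule.factor (powFiltration_le s C (Ordinal.natCast_lt_omega0 n).le) z) : y = z := by
  obtain ⟨y, rfl⟩ := Submodule.mkQ_surjective _ y
  obtain ⟨z, rfl⟩ := Submodule.mkQ_surjective _ z
  refine (Submodule.Quotient.eq _).2 ?_
  rw [powFiltration_omega0, Submodule.mem_iInf]
  intro n
  have h1 := h n
  rw [Submodule.factor_mk, Submodule.factor_mk] at h1
  rw [← powFiltration_natCast]
  exact (Submodule.Quotient.eq _).1 h1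

theorem IsElementContramodule.existsUnique_factor_powFiltration (hC : IsElementContramodule s C)
    (x : ∀ i : Set.Iio Ordinal.omega0.{u}, C ⧸ powFiltration s C (i : Ordinal.{u}))
    (hx : ∀ (i k : Set.Iio Ordinal.omega0.{u}) (hik : (i : Ordinal.{u}) ≤ k),
      Submodule.factor (powFiltration_le s C hik) (x k) = x i) :
    ∃! y : C ⧸ powFiltration s C Ordinal.omega0.{u}, ∀ i : Set.Iio Ordinal.omega0.{u},
      Submodule.factor (powFiltration_le s C (le_of_lt i.2)) y = x i := by
  have hω : ∀ n : ℕ, (n : Ordinal.{u}) < Ordinal.omega0 := Ordinal.natCast_lt_omega0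
  refine existsUnique_of_exists_of_unique ?_ fun y z hy hz =>
    eq_of_forall_factor_powFiltration_eq fun n => (hy ⟨n, hω n⟩).trans (hz ⟨n, hω n⟩).symm
  choose c hc using fun n : ℕ => Submodule.mkQ_surjective _ (x ⟨n, hω n⟩)
  obtain ⟨y, hy⟩ := hC.exists_forall_sub_mem_powFiltration (c := c) fun n => by
    have hn : (n : Ordinal.{u}) ≤ (n + 1 : ℕ) := Nat.cast_le.2 n.le_succ
    have := hx ⟨n, hω n⟩ ⟨(n + 1 : ℕ), hω (n + 1)⟩ hn
    rw [← hc, ← hc, Submodule.factor_mk] at this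
    exact (Submodule.Quotient.eq _).1 this
  refine ⟨Submodule.mkQ _ y, ?_⟩
  rintro ⟨i, hi⟩
  obtain ⟨n, rfl⟩ := Ordinal.lt_omega0.1 hi
  rw [Submodule.factor_mk]
  refine Eq.trans ?_ (hc n)
  exact (Submodule.Quotient.eq _).2 (hy n)

theorem IsElementContramodule.isProjIteratedExtension (hC : IsElementContramodule s C) :
    IsProjIteratedExtension (R := R) Ordinal.omega0.{u} (fun i => C ⧸ powFiltration s C i)
      (fun _ _ hij => Submodule.factor (powFiltration_le s C hij)) where
  map_id i _ x := by
    obtain ⟨x, rfl⟩ := Submodule.mkQ_surjective _ x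
    exact Submodule.factor_mk _ _
  map_comp i j k hij hjk _ x := Submodule.factor_comp_apply _ _ x
  zero := by
    rw [Submodule.Quotient.subsingleton_iff, eq_top_iff]
    intro x _
    refine mem_powFiltration.2 fun n hn => ⟨x, ?_⟩
    have : n = 0 := Nat.le_zero.1 (by exact_mod_cast hn)
    rw [this, pow_zero, one_smul]
  succ i _ := Submodule.factor_surjective _
  limit j hj hlim x hx := by
    obtain rfl : j = Ordinal.omega0 := le_antisymm hj (Ordinal.omega0_le_of_isSuccLimit hlim)
    exact hC.existsUnique_factor_powFiltration x hx

theorem IsElementContramodule.simplyRightObtainable (hC : IsElementContramodule s C)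
    (h1 : ∀ n : ℕ, SimplyRightObtainable E (LinearMap.ker (LinearMap.lsmul R C (s ^ n))))
    (h2 : ∀ (n : ℕ) (A B : Submodule R C) (hAB : A ≤ B),
      A = LinearMap.range (LinearMap.lsmul R C (s ^ (n + 1))) →
      B = LinearMap.range (LinearMap.lsmul R C (s ^ n)) →
      SimplyRightObtainable E (LinearMap.ker (Submodule.factor hAB))) :
    SimplyRightObtainable E C := by
  have hquot : SimplyRightObtainable E (C ⧸ powFiltration s C Ordinal.omega0) := by
    refine .iterated Ordinal.omega0 (fun i => C ⧸ powFiltration s C i) _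
      hC.isProjIteratedExtension fun i hi => ?_
    obtain ⟨n, rfl⟩ := Ordinal.lt_omega0.1 hi
    refine h2 n _ _ (powFiltration_le s C (Order.le_succ _)) ?_
      (powFiltration_natCast s C n)
    rw [← powFiltration_natCast, Nat.cast_succ]
    rfl
  rw [powFiltration_omega0] at hquot
  exact .extension (Submodule.subtype _) (Submodule.mkQ _) (Submodule.injective_subtype _)
    (LinearMap.exact_subtype_mkQ _) (Submodule.mkQ_surjective _)
    (hC.obtainable_iInf_range_pow h1) hquot

end Completion

/-! ### Induction over generators and the conclusion -/

section Main

variable {R : Type u} [CommRing R]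

/-- `L` lists the generators not yet known to act nilpotently. Passing to the building blocks of the
filtration for its head `s` makes `s` nilpotent, and kernels and cokernels preserve the contramodule
property for the rest. -/
theorem simplyRightObtainable_of_forall_isElementContramodule {G : Set (Ideal R)}
    (hmono : ∀ {I J : Ideal R}, I ≤ J → I ∈ G → J ∈ G) (hpow : ∀ I ∈ G, ∀ n : ℕ, I ^ n ∈ G)
    {S : Finset R} (hS : Ideal.span (S : Set R) ∈ G) (L : List R) :
    ∀ (C : Type u) [AddCommGroup C] [Module R C], (∀ s ∈ L, IsElementContramodule s C) →
      (∀ s ∈ S, s ∈ L ∨ ∃ N : ℕ, ∀ x : C, s ^ N • x = 0) →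
      SimplyRightObtainable (R := R)
        (fun M [AddCommGroup M] [Module R M] => IsQuotientRingModule G M) C := by
  induction L with
  | nil =>
    intro C _ _ _ hkill
    let J := Module.annihilator R C
    -- With `L` empty, every generator acts nilpotently; finite generation puts a power of the span,
    -- which is in `G`, inside the annihilator.
    have hJ : Ideal.span (S : Set R) ≤ J.radical := Ideal.span_le.2 fun s hs => by
      obtain h | ⟨N, hN⟩ := hkill s hs
      · exact absurd h List.not_mem_nil
      · exact ⟨N, Module.mem_annihilator.2 hN⟩
    obtain ⟨n, hn⟩ := Ideal.exists_pow_le_of_le_radical_of_fg hJ ⟨S, rfl⟩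
    have htor : Module.IsTorsionBySet R C J := fun x a => Module.mem_annihilator.1 a.2 x
    exact .of ⟨J, hmono hn (hpow _ hS n), htor.module, htor.isScalarTower⟩
  | cons s L ih =>
    intro C _ _ hC hkill
    have hs := hC s List.mem_cons_self
    have hL : ∀ r ∈ L, IsElementContramodule r C := fun r hr => hC r (List.mem_cons_of_mem _ hr)
    refine hs.simplyRightObtainable (fun n => ih _ (fun r hr => ?_) fun r hr => ?_)
      fun n A B hAB hA hB => ih _ (fun r hr => ?_) fun r hr => ?_
    · exact (hL r hr).ker (hL r hr) _
    · rcases hkill r hr with h | ⟨N, hN⟩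
      · rcases List.mem_cons.1 h with rfl | h
        · exact Or.inr ⟨n, fun x => Subtype.ext x.2⟩
        · exact Or.inl h
      · exact Or.inr ⟨N, fun x => Subtype.ext (hN x)⟩
    · subst hA hB
      exact ((hL r hr).coker (hL r hr) _).ker ((hL r hr).coker (hL r hr) _) _
    · have hq : ∀ x : C ⧸ A, ∃ y : C, A.mkQ y = x := Submodule.mkQ_surjective A
      rcases hkill r hr with h | ⟨N, hN⟩
      · rcases List.mem_cons.1 h with rfl | h
        · refine Or.inr ⟨1, ?_⟩
          rintro ⟨x, hx⟩
          obtain ⟨y, rfl⟩ := hq x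
          have hy : y ∈ B := (Submodule.Quotient.mk_eq_zero B).1 hx
          rw [hB] at hy
          obtain ⟨z, rfl⟩ := hy
          refine Subtype.ext ((Submodule.Quotient.mk_eq_zero A).2 ?_)
          rw [hA]
          refine ⟨z, ?_⟩
          simp [pow_succ', mul_smul]
        · exact Or.inl h
      · refine Or.inr ⟨N, ?_⟩
        rintro ⟨x, hx⟩
        obtain ⟨y, rfl⟩ := hq x
        refine Subtype.ext ?_
        change r ^ N • A.mkQ y = 0
        rw [← map_smul, hN, map_zero]

theorem IsUContramodule.simplyRightObtainable {U : Type u} [CommRing U] [Algebra R U]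
    [Module.Flat R U] [Algebra.IsEpi R U]
    (hG : IsSemilocalZeroDimFilter (gabrielFilter R U)) {C : Type u} [AddCommGroup C] [Module R C]
    (hC : IsUContramodule R U C) :
    SimplyRightObtainable (R := R)
      (fun M [AddCommGroup M] [Module R M] => IsQuotientRingModule (gabrielFilter R U) M) C := by
  obtain ⟨e⟩ := hC.nonempty_equiv_pi hG
  refine .of_equiv e (.product _ fun m => ?_)
  obtain ⟨S, hSm, hS⟩ := hG.exists_finset _ m.2
  exact simplyRightObtainable_of_forall_isElementContramodule hG.mono
    (fun _ => pow_mem_gabrielFilter) hS S.toList _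
    (fun s hs => hC.isElementContramodule hG m (hSm (Finset.mem_toList.1 hs)))
    fun s hs => Or.inl (Finset.mem_toList.2 hs)

end Main

theorem proposition6p1 (R U : Type u) [CommRing R] [CommRing U] [Algebra R U]
    [Module.Flat R U] [Algebra.IsEpi R U]
    (hG : ∀ I ∈ gabrielFilter R U, IsSemilocalOfKrullDimZero (R ⧸ I))
    (C : Type u) [AddCommGroup C] [Module R C] :
    IsUContramodule R U C ↔
      SimplyRightObtainable (R := R)
        (fun M [AddCommGroup M] [Module R M] => IsQuotientRingModule (gabrielFilter R U) M) C :=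
  ⟨fun h => h.simplyRightObtainable (isSemilocalZeroDimFilter_gabrielFilter hG),
    fun h => h.isUContramodule⟩
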